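/- There are absolute constants $C, c_1, c_2 > 0$ such that the following holds. Let $p_1,p_2\ge 1$ and let $Z_t=(F_t^\top,X_t^\top)^\top\in\mathbb{R}^{p_1+p_2}$, $t\in\mathbb{Z}$, with $F_t\in\mathbb{R}^{p_1}$, $X_t\in\mathbb{R}^{p_2}$, be a stable, stationary, mean-zero Gaussian VAR(1) process $Z_t=AZ_{t-1}+W_t$, where $\det(I-zA)\neq 0$ for all complex $|z|\le 1$, and the $W_t\sim\mathcal N(0,\Sigma_w)$ are serially uncorrelated and independent of the past of $Z$. Let $f_Z(\theta)=\frac1{2\pi}\sum_{h\in\mathbb Z}\mathbb E(Z_tZ_{t+h}^\top)e^{i\theta h}$ be its spectral density, and put $\mathcal M=\operatorname{ess\,sup}_{\theta\in[-\pi,\pi]}\Lambda_{\max}(f_Z(\theta))$, $\mathfrak m=\operatorname{ess\,inf}_{\theta\in[-\pi,\pi]}\Lambda_{\min}(f_Z(\theta))$. Let $\mathbf F_{n-1}$, $\mathbf X_{n-1}$ be the random matrices with rows $F_1,\dots,F_{n-1}$ and $X_1,\dots,X_{n-1}$, let $\Delta_{\mathbf F}\in\mathbb R^{(n-1)\times p_1}$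 be non-random, and let $$\widehat{\mathbf Z}_{n-1}=[\mathbf F_{n-1},\mathbf X_{n-1}]+[\Delta_{\mathbf F},O],\qquad S_{\Delta_{\mathbf F}}=\Delta_{\mathbf F}^\top\Delta_{\mathbf F}/n,\qquad d=\Lambda_{\max}^{1/2}(S_{\Delta_{\mathbf F}}).$$ Suppose that $\mathfrak m/\mathcal M^{1/2}>c_0\, d$ for some $c_0\ge 6$ and that $n\ge C\log(p_1+p_2)$. Put $\omega=54\,\mathcal M/\mathfrak m$ and $$\alpha=\pi\mathfrak m-54\,d\sqrt{2\pi\mathcal M+\pi\mathfrak m/27},\qquad \tau_n=\Big(\tfrac{\pi}{2}\mathfrak m+27\,d\sqrt{2\pi\mathcal M+\pi\mathfrak m/27}\Big)\,\omega^2\sqrt{\frac{\log(p_1+p_2)}{n}} .$$ If $c_0\ge 6\sqrt{165\pi}$, then $\alpha>0$. Whenever $\alpha>0$, with probability at least $1-c_1e^{-c_2n}$ the matrix $\widehat{\mathbf Z}_{n-1}$ satisfies the restricted strong convexity (RSC) condition with curvature $\alpha>0$ and tolerance $\tau_n\ge0$, that is, $$\frac1{2n}\|\widehat{\mathbf Z}_{n-1}\Delta\|_{\mathrm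 F}^2\ \ge\ \frac{\alpha}{2}\|\Delta\|_{\mathrm F}^2-\tau_n\|\Delta\|_1^2\qquad\text{for all }\Delta\in\mathbb R^{(p_1+p_2)\times(p_1+p_2)},$$ where $\|\Delta\|_1=\sum_{i,j}|\Delta_{ij}|$. -/

import Mathlib

open MeasureTheory ProbabilityTheory Matrix

noncomputable section

/-- Largest eigenvalue of a Hermitian (in particular, of a real symmetric) matrix. -/
def lambdaMax {𝕜 ι : Type*} [RCLike 𝕜] [Fintype ι] [DecidableEq ι] (M : Matrix ι ι 𝕜) : ℝ :=
  sSup (spectrum ℝ M)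

/-- Smallest eigenvalue of a Hermitian (in particular, of a real symmetric) matrix. -/
def lambdaMin {𝕜 ι : Type*} [RCLike 𝕜] [Fintype ι] [DecidableEq ι] (M : Matrix ι ι 𝕜) : ℝ :=
  sInf (spectrum ℝ M)

/-- Sample covariance `S_E = Eᵀ E / n` of a data matrix `E`, normalised by the sample size `n`. -/
def sampleCov {κ ι : Type*} [Fintype κ] (n : ℕ) (E : Matrix κ ι ℝ) : Matrix ι ι ℝ :=
  (1 / (n : ℝ)) • (Eᵀ * E)

/-- Squared Frobenius norm. -/
def frobSq {κ ι : Type*} [Fintype κ] [Fintype ι] (M : Matrix κ ι ℝ) : ℝ :=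
  ∑ i, ∑ j, M i j ^ 2

/-- Element-wise `ℓ₁` norm. -/
def elemL1 {κ ι : Type*} [Fintype κ] [Fintype ι] (M : Matrix κ ι ℝ) : ℝ :=
  ∑ i, ∑ j, |M i j|

/-- Restricted strong convexity of a design matrix `X` with respect to the element-wise `ℓ₁` norm,
with curvature `α > 0` and tolerance `τ ≥ 0`; the quadratic loss is normalised by `n`. -/
def SatisfiesRSC {κ ι : Type*} [Fintype κ] [Fintype ι] (n : ℕ) (X : Matrix κ ι ℝ) (α τ : ℝ) :
    Prop :=
  0 < α ∧ 0 ≤ τ ∧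
    ∀ D : Matrix ι ι ℝ,
      α / 2 * frobSq D - τ * elemL1 D ^ 2 ≤ 1 / (2 * (n : ℝ)) * frobSq (X * D)

section Processes

variable {Ω ι : Type*} [MeasurableSpace Ω]

/-- Lag-`h` autocovariance `Σ_Z(h) = E (Z_t Z_{t+h}ᵀ)` (at `t = 0`) of a mean-zero stationary
process. -/
def autocov (P : Measure Ω) (Z : ℤ → Ω → ι → ℝ) (h : ℤ) : Matrix ι ι ℝ :=
  Matrix.of fun i j => ∫ x, Z 0 x i * Z h x j ∂P

/-- Spectral density `f_Z(θ) = (2π)⁻¹ ∑_{h ∈ ℤ} Σ_Z(h) e^{iθh}`. -/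
def spectralDensity (P : Measure Ω) (Z : ℤ → Ω → ι → ℝ) (θ : ℝ) : Matrix ι ι ℂ :=
  Matrix.of fun i j =>
    1 / (2 * (Real.pi : ℂ)) *
      ∑' h : ℤ, (autocov P Z h i j : ℂ) * Complex.exp (Complex.I * (θ : ℂ) * (h : ℂ))

/-- Upper extreme of the spectrum: the essential supremum over `[-π, π]` of the largest eigenvalue
of the spectral density. -/
def specUpper [Fintype ι] [DecidableEq ι] (P : Measure Ω) (Z : ℤ → Ω → ι → ℝ) : ℝ :=
  essSup (fun θ => lambdaMax (spectralDensity P Z θ))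
    (volume.restrict (Set.Icc (-Real.pi) Real.pi))

/-- Lower extreme of the spectrum: the essential infimum over `[-π, π]` of the smallest eigenvalue
of the spectral density. -/
def specLower [Fintype ι] [DecidableEq ι] (P : Measure Ω) (Z : ℤ → Ω → ι → ℝ) : ℝ :=
  essInf (fun θ => lambdaMin (spectralDensity P Z θ))
    (volume.restrict (Set.Icc (-Real.pi) Real.pi))

/-- `Z` is a stable, stationary, mean-zero Gaussian `VAR(1)` process
`Z_t = A Z_{t-1} + W_t`, where the `W_t ~ N(0, Σ_w)` are serially uncorrelated and independent of
the past of `Z`. -/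
structure IsStableGaussianVAR [Fintype ι] [DecidableEq ι] (P : Measure Ω)
    (Z W : ℤ → Ω → ι → ℝ) (A Sw : Matrix ι ι ℝ) : Prop where
  /-- Stability: `det (I - z A) ≠ 0` on the closed complex unit disc. -/
  stable : ∀ z : ℂ, ‖z‖ ≤ 1 → (1 - z • A.map (fun a : ℝ => (a : ℂ))).det ≠ 0
  /-- The dynamics. -/
  dynamics : ∀ t, ∀ᵐ x ∂P, Z t x = A *ᵥ Z (t - 1) x + W t x
  gaussian : IsGaussianProcess Z P
  mean_zero : ∀ t i, ∫ x, Z t x i ∂P = 0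
  stationary : ∀ t h i j, ∫ x, Z t x i * Z (t + h) x j ∂P = ∫ x, Z 0 x i * Z h x j ∂P
  noise_gaussian : ∀ t, HasGaussianLaw (W t) P
  noise_mean_zero : ∀ t i, ∫ x, W t x i ∂P = 0
  noise_cov : ∀ t i j, ∫ x, W t x i * W t x j ∂P = Sw i j
  noise_uncorrelated : ∀ s t, s ≠ t → ∀ i j, ∫ x, W s x i * W t x j ∂P = 0
  noise_indep_past : ∀ s t, s < t → IndepFun (W t) (Z s) P

/-- The data matrix with rows `U_1, …, U_k`. -/
def dataMatrix (U : ℤ → Ω → ι → ℝ) (k : ℕ) (x : Ω) : Matrix (Fin k) ι ℝ :=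
  Matrix.of fun r j => U ((r : ℕ) + 1 : ℤ) x j

/-- The joint process `Z_t = (F_tᵀ, X_tᵀ)ᵀ`. -/
def jointProcess {ι₁ ι₂ : Type*} (F : ℤ → Ω → ι₁ → ℝ) (X : ℤ → Ω → ι₂ → ℝ) :
    ℤ → Ω → ι₁ ⊕ ι₂ → ℝ :=
  fun t x => Sum.elim (F t x) (X t x)

end Processes

/-- The error-contaminated design `[F_{n-1}, X_{n-1}] + [Δ_F, O]`. -/
def contaminatedDesign {Ω ι₁ ι₂ : Type*} [MeasurableSpace Ω] (F : ℤ → Ω → ι₁ → ℝ)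
    (X : ℤ → Ω → ι₂ → ℝ) (n : ℕ) (DF : Matrix (Fin (n - 1)) ι₁ ℝ) (x : Ω) :
    Matrix (Fin (n - 1)) (ι₁ ⊕ ι₂) ℝ :=
  Matrix.fromCols (dataMatrix F (n - 1) x) (dataMatrix X (n - 1) x) + Matrix.fromCols DF 0

/-- The curvature `π m - 54 d √(2π M + π m / 27)`, for spectral extremes `m`, `M` and error
magnitude `d`. -/
def rscCurvature (m M d : ℝ) : ℝ :=
  Real.pi * m - 54 * d * Real.sqrt (2 * Real.pi * M + Real.pi * m / 27)

/-- The tolerance `(π m / 2 + 27 d √(2π M + π m / 27)) ω² √(log p / n)` with `ω = 54 M / m`. -/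
def rscTolerance (m M d : ℝ) (p n : ℕ) : ℝ :=
  (Real.pi / 2 * m + 27 * d * Real.sqrt (2 * Real.pi * M + Real.pi * m / 27)) *
    (54 * (M / m)) ^ 2 * Real.sqrt (Real.log p / n)

end

/-!
Write `𝔪 ≤ 𝓜` for the spectral extremes, `p = p₁ + p₂`, and `B = 𝐙 + E` for the contaminated
design with `n - 1` rows. Working column by column, the claim reduces to a bound
`‖B v‖² ≥ π 𝔪 n ‖v‖² - K ‖v‖₁²` for all vectors `v`, with `K` of order `𝓜 log p`. Three
ingredients give it.

*Covariance.* By stability and Gelfand's formula the autocovariances are summable, so the spectral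
density is continuous and its extremes are true essential bounds. Fourier inversion turns the
variance of `∑ t, w t * (u · Z_t)` into an integral of the spectral density against
`|∑ t, w t e^{itθ}|²`, so `(u · Z_1, …, u · Z_{n-1})` is a Gaussian vector with covariance between
`2π 𝔪 ‖u‖²` and `2π 𝓜 ‖u‖²` times the identity (`isCentredGaussian_projSample`,
`projSample_cov_bounds`).

*Tails.* Writing `exp (-s ‖x‖²)` and `exp (s ‖x‖²)` as Gaussian averages of `exp (i g · x)` and
`exp (g · x)` bounds the Laplace transform of `‖Y + μ‖²` by that of a chi-square variable. In the
lower tail the deterministic shift `μ` only changes a phase, so the contamination `E` costs nothing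
there, and the exponent is an absolute multiple of `n`, whatever `𝓜 / 𝔪` is
(`measureReal_sum_sq_lt`, `measureReal_le_sum_sq`).

*Uniformity.* Maurey's empirical method represents `v` as `‖v‖₁ / s` times the mean of a random sum
of `s` signed unit vectors. There are only `(2p)^s` such sums, so with `s` of order `n / log p` a union
bound makes the lower tail estimate hold at all of them, and averaging transfers it to every `v` at
the price `max_j ‖B e_j‖² ‖v‖₁² / s` (`sum_mulVec_sq_ge_of_signedSum`). Since `𝓜 / 𝔪 ≥ 1` and
`log p ≤ n / 100`, this is below the tolerance.
-/

/-! ### Chi-square type bounds for Gaussian vectors -/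

lemma integral_exp_neg_mul_sq_gaussianReal {b : ℝ} (hb : -(1 / 2) < b) :
    ∫ x, Real.exp (-b * x ^ 2) ∂(gaussianReal 0 1) = (√(1 + 2 * b))⁻¹ := by
  rw [integral_gaussianReal_eq_integral_smul one_ne_zero]
  have h : ∀ x : ℝ, gaussianPDFReal 0 1 x • Real.exp (-b * x ^ 2)
      = (√(2 * Real.pi))⁻¹ * Real.exp (-(b + 1 / 2) * x ^ 2) := by
    intro x
    rw [gaussianPDFReal_def, smul_eq_mul, mul_assoc, ← Real.exp_add]
    simp only [NNReal.coe_one, mul_one, sub_zero]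
    congr 2
    ring
  simp_rw [h]
  rw [integral_const_mul, integral_gaussian, ← Real.sqrt_inv, ← Real.sqrt_inv,
    ← Real.sqrt_mul (by positivity)]
  congr 1
  have := Real.pi_ne_zero
  have h3 : 1 + 2 * b ≠ 0 := by linarith
  rw [show b + 1 / 2 = (1 + 2 * b) / 2 by ring]
  field_simp

lemma integrable_exp_neg_mul_sq_gaussianReal {b : ℝ} (hb : -(1 / 2) < b) :
    Integrable (fun x : ℝ => Real.exp (-b * x ^ 2)) (gaussianReal 0 1) := by
  by_contra h
  have h1 := integral_exp_neg_mul_sq_gaussianReal hb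
  rw [integral_undef h] at h1
  have : 0 < (√(1 + 2 * b))⁻¹ := by
    have : 0 < 1 + 2 * b := by linarith
    positivity
  linarith

section Vector

variable {κ : Type*} [Fintype κ]

/-- The law of a vector with independent standard normal coordinates. -/
noncomputable abbrev stdNormal (κ : Type*) [Fintype κ] : Measure (κ → ℝ) :=
  Measure.pi fun _ => gaussianReal 0 1

lemma integral_exp_neg_mul_sum_sq_stdNormal {b : ℝ} (hb : -(1 / 2) < b) :
    ∫ g, Real.exp (-b * ∑ i, g i ^ 2) ∂(stdNormal κ) = (√(1 + 2 * b))⁻¹ ^ Fintype.card κ := by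
  simp_rw [Finset.mul_sum, Real.exp_sum]
  rw [integral_fintype_prod_eq_pow (fun x : ℝ => Real.exp (-b * x ^ 2)),
    integral_exp_neg_mul_sq_gaussianReal hb]

lemma integrable_exp_neg_mul_sum_sq_stdNormal {b : ℝ} (hb : -(1 / 2) < b) :
    Integrable (fun g : κ → ℝ => Real.exp (-b * ∑ i, g i ^ 2)) (stdNormal κ) := by
  simp_rw [Finset.mul_sum, Real.exp_sum]
  exact Integrable.fintype_prod (f := fun (_ : κ) (x : ℝ) => Real.exp (-b * x ^ 2))
    fun _ => integrable_exp_neg_mul_sq_gaussianReal hb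

/-- The characteristic function of a standard normal vector. -/
lemma integral_cexp_stdNormal (c : ℝ) (x : κ → ℝ) :
    ∫ g, Complex.exp (((c * ∑ i, g i * x i : ℝ) : ℂ) * Complex.I) ∂(stdNormal κ)
      = (Real.exp (-(c ^ 2 / 2 * ∑ i, x i ^ 2)) : ℂ) := by
  have h : ∀ g : κ → ℝ, Complex.exp (((c * ∑ i, g i * x i : ℝ) : ℂ) * Complex.I)
      = ∏ i, Complex.exp (((c * x i : ℝ) : ℂ) * (g i : ℂ) * Complex.I) := by
    intro g
    rw [← Complex.exp_sum]
    congr 1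
    push_cast
    rw [Finset.mul_sum, Finset.sum_mul]
    exact Finset.sum_congr rfl fun i _ => by ring
  simp_rw [h]
  rw [integral_fintype_prod_eq_prod
    (f := fun i (y : ℝ) => Complex.exp (((c * x i : ℝ) : ℂ) * (y : ℂ) * Complex.I))]
  have h1 : ∀ t : ℝ, ∫ y : ℝ, Complex.exp ((t : ℂ) * (y : ℂ) * Complex.I) ∂(gaussianReal 0 1)
      = Complex.exp (-(t ^ 2 / 2 : ℝ)) := by
    intro t
    have := charFun_gaussianReal (μ := 0) (v := 1) t
    rw [charFun_apply_real] at this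
    rw [this]
    push_cast
    simp
  simp_rw [h1]
  rw [← Complex.exp_sum]
  push_cast
  congr 1
  rw [Finset.mul_sum, ← Finset.sum_neg_distrib]
  exact Finset.sum_congr rfl fun i _ => by ring

/-- The moment generating function of a standard normal vector. -/
lemma lintegral_exp_stdNormal (c : ℝ) (x : κ → ℝ) :
    ∫⁻ g, ENNReal.ofReal (Real.exp (c * ∑ i, g i * x i)) ∂(stdNormal κ)
      = ENNReal.ofReal (Real.exp (c ^ 2 / 2 * ∑ i, x i ^ 2)) := by
  have h : ∀ g : κ → ℝ, Real.exp (c * ∑ i, g i * x i)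
      = ∏ i, Real.exp (c * x i * g i) := by
    intro g
    rw [← Real.exp_sum, Finset.mul_sum]
    congr 1
    exact Finset.sum_congr rfl fun i _ => by ring
  have h1 : ∀ t : ℝ, ∫ y : ℝ, Real.exp (t * y) ∂(gaussianReal 0 1) = Real.exp (t ^ 2 / 2) := by
    intro t
    have := mgf_gaussianReal (p := gaussianReal 0 1) (X := id) (μ := 0) (v := 1) (by simp) t
    simpa [mgf] using this
  have h2 : ∀ t : ℝ, Integrable (fun y : ℝ => Real.exp (t * y)) (gaussianReal 0 1) :=
    fun t => integrable_exp_mul_gaussianReal t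
  simp_rw [h]
  rw [← ofReal_integral_eq_lintegral_ofReal
    (Integrable.fintype_prod_dep (f := fun i (y : ℝ) => Real.exp (c * x i * y))
      fun i => h2 _)
    (Filter.Eventually.of_forall fun g => Finset.prod_nonneg fun i _ => (Real.exp_pos _).le),
    integral_fintype_prod_eq_prod (f := fun i (y : ℝ) => Real.exp (c * x i * y))]
  simp_rw [h1]
  rw [← Real.exp_sum, Finset.mul_sum]
  congr 2
  exact Finset.sum_congr rfl fun i _ => by ring

variable {Ω : Type*} [MeasurableSpace Ω] {P : Measure Ω}

/-- `Y` is a centred Gaussian vector whose covariance form `w ↦ Var (∑ i, w i * Y i)` is the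
function `v`, expressed through its one-dimensional projections. -/
structure IsCentredGaussian (P : Measure Ω) (Y : κ → Ω → ℝ) (v : (κ → ℝ) → ℝ) : Prop where
  aemeasurable : ∀ i, AEMeasurable (Y i) P
  map_eq : ∀ w : κ → ℝ,
    P.map (fun x => ∑ i, w i * Y i x) = gaussianReal 0 (v w).toNNReal
  nonneg : ∀ w, 0 ≤ v w

variable {Y : κ → Ω → ℝ} {v : (κ → ℝ) → ℝ}

lemma IsCentredGaussian.aemeasurable_sum (hY : IsCentredGaussian P Y v) (w : κ → ℝ) :
    AEMeasurable (fun x => ∑ i, w i * Y i x) P :=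
  Finset.aemeasurable_fun_sum _ fun i _ => (hY.aemeasurable i).const_mul _

variable [IsProbabilityMeasure P]

/-- The Laplace transform of the squared norm of a Gaussian vector. A deterministic shift `μ` only
contributes a unimodular factor to the characteristic function, so it cannot increase the
transform. -/
lemma IsCentredGaussian.integral_exp_neg_le (hY : IsCentredGaussian P Y v) (μ : κ → ℝ) {a : ℝ}
    (ha : 0 < a) (hv : ∀ w, a * ∑ i, w i ^ 2 ≤ v w) :
    ∫ x, Real.exp (-(1 / (2 * a) * ∑ i, (Y i x + μ i) ^ 2)) ∂P ≤ (√2)⁻¹ ^ Fintype.card κ := by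
  set c : ℝ := (√a)⁻¹ with hc
  have hc2 : c ^ 2 = 1 / a := by rw [hc, inv_pow, Real.sq_sqrt ha.le, one_div]
  set f : Ω → (κ → ℝ) → ℂ := fun x g =>
    Complex.exp (((c * ∑ i, g i * (Y i x + μ i) : ℝ) : ℂ) * Complex.I) with hf
  have hmeas : AEStronglyMeasurable (Function.uncurry f) (P.prod (stdNormal κ)) := by
    have h1 : ∀ i, AEMeasurable (fun z : Ω × (κ → ℝ) => Y i z.1) (P.prod (stdNormal κ)) :=
      fun i => (hY.aemeasurable i).comp_fst
    have h2 : ∀ i, AEMeasurable (fun z : Ω × (κ → ℝ) => z.2 i) (P.prod (stdNormal κ)) :=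
      fun i => ((measurable_pi_apply i).comp measurable_snd).aemeasurable
    have h3 : AEMeasurable (fun z : Ω × (κ → ℝ) => c * ∑ i, z.2 i * (Y i z.1 + μ i))
        (P.prod (stdNormal κ)) :=
      (Finset.aemeasurable_fun_sum _ fun i _ => (h2 i).mul ((h1 i).add_const _)).const_mul _
    exact (Complex.measurable_exp.comp_aemeasurable
      ((Complex.measurable_ofReal.comp_aemeasurable h3).mul_const _)).aestronglyMeasurable
  have hint : Integrable (Function.uncurry f) (P.prod (stdNormal κ)) := by
    refine Integrable.of_bound hmeas 1 (Filter.Eventually.of_forall fun z => ?_)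
    simp only [Function.uncurry, hf]
    rw [Complex.norm_exp_ofReal_mul_I]
  have hswap := integral_integral_swap hint
  have hleft : ∀ x, ∫ g, f x g ∂(stdNormal κ)
      = (Real.exp (-(1 / (2 * a) * ∑ i, (Y i x + μ i) ^ 2)) : ℂ) := by
    intro x
    rw [hf]
    simp only
    rw [integral_cexp_stdNormal c fun i => Y i x + μ i, hc2]
    congr 4
    field_simp
  have hright : ∀ g, ‖∫ x, f x g ∂P‖ ≤ Real.exp (-(1 / 2) * ∑ i, g i ^ 2) := by
    intro g
    have h1 : ∀ x, f x g = Complex.exp (((c * ∑ i, g i * μ i : ℝ) : ℂ) * Complex.I)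
        * Complex.exp ((c : ℂ) * ((∑ i, g i * Y i x : ℝ) : ℂ) * Complex.I) := by
      intro x
      simp only [hf]
      rw [← Complex.exp_add]
      congr 1
      simp_rw [mul_add, Finset.sum_add_distrib]
      push_cast
      ring
    simp_rw [h1]
    rw [integral_const_mul, norm_mul, Complex.norm_exp_ofReal_mul_I, one_mul]
    have h2 : ∫ x, Complex.exp ((c : ℂ) * ((∑ i, g i * Y i x : ℝ) : ℂ) * Complex.I) ∂P
        = charFun (P.map (fun x => ∑ i, g i * Y i x)) c := by
      rw [charFun_apply_real, integral_map (hY.aemeasurable_sum g)]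
      exact (Complex.measurable_exp.comp ((measurable_const.mul
        Complex.measurable_ofReal).mul_const _)).aestronglyMeasurable
    rw [h2, hY.map_eq, charFun_gaussianReal, Complex.norm_exp]
    apply Real.exp_le_exp.2
    have h3 : (((c : ℂ) * ((0 : ℝ) : ℂ) * Complex.I
        - (((v g).toNNReal : ℝ) : ℂ) * (c : ℂ) ^ 2 / 2).re) = -(v g * c ^ 2 / 2) := by
      rw [Real.coe_toNNReal _ (hY.nonneg g)]
      have : ((c : ℂ) * ((0 : ℝ) : ℂ) * Complex.I - ((v g : ℝ) : ℂ) * (c : ℂ) ^ 2 / 2)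
          = ((-(v g * c ^ 2 / 2) : ℝ) : ℂ) := by push_cast; ring
      rw [this, Complex.ofReal_re]
    refine h3.le.trans ?_
    rw [hc2]
    have h4 : ∑ i, g i ^ 2 ≤ v g * (1 / a) := by
      rw [mul_one_div, le_div_iff₀ ha]
      linarith [hv g]
    linarith
  have hreal : ((∫ x, Real.exp (-(1 / (2 * a) * ∑ i, (Y i x + μ i) ^ 2)) ∂P : ℝ) : ℂ)
      = ∫ g, ∫ x, f x g ∂P ∂(stdNormal κ) := by
    rw [← hswap]
    simp_rw [hleft]
    exact integral_ofReal.symm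
  calc ∫ x, Real.exp (-(1 / (2 * a) * ∑ i, (Y i x + μ i) ^ 2)) ∂P
      ≤ ‖((∫ x, Real.exp (-(1 / (2 * a) * ∑ i, (Y i x + μ i) ^ 2)) ∂P : ℝ) : ℂ)‖ := by
        rw [Complex.norm_real]; exact le_abs_self _
    _ ≤ ∫ g, Real.exp (-(1 / 2) * ∑ i, g i ^ 2) ∂(stdNormal κ) := by
        rw [hreal]
        exact norm_integral_le_of_norm_le
          (integrable_exp_neg_mul_sum_sq_stdNormal (by norm_num))
          (Filter.Eventually.of_forall hright)
    _ = (√2)⁻¹ ^ Fintype.card κ := by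
        rw [integral_exp_neg_mul_sum_sq_stdNormal (by norm_num)]
        norm_num

/-- Lower tail of the squared norm of a shifted Gaussian vector, uniform in the shift. -/
lemma IsCentredGaussian.measureReal_sum_sq_lt (hY : IsCentredGaussian P Y v) (μ : κ → ℝ) {a : ℝ}
    (ha : 0 < a) (hv : ∀ w, a * ∑ i, w i ^ 2 ≤ v w) (r : ℝ) :
    P.real {x | ∑ i, (Y i x + μ i) ^ 2 < r * a} ≤
      Real.exp (r / 2) * (√2)⁻¹ ^ Fintype.card κ := by
  set φ : Ω → ℝ := fun x => Real.exp (-(1 / (2 * a) * ∑ i, (Y i x + μ i) ^ 2)) with hφ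
  have hφm : AEStronglyMeasurable φ P := by
    have h1 : AEMeasurable (fun x => ∑ i, (Y i x + μ i) ^ 2) P :=
      Finset.aemeasurable_fun_sum _ fun i _ => ((hY.aemeasurable i).add_const _).pow_const _
    exact (Real.measurable_exp.comp_aemeasurable (h1.const_mul _).neg).aestronglyMeasurable
  have hφi : Integrable φ P := by
    refine Integrable.of_bound hφm 1 (Filter.Eventually.of_forall fun x => ?_)
    rw [Real.norm_eq_abs, abs_of_pos (Real.exp_pos _)]
    apply Real.exp_le_one_iff.2
    have : 0 ≤ ∑ i, (Y i x + μ i) ^ 2 := Finset.sum_nonneg fun i _ => sq_nonneg _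
    have h2 : 0 ≤ 1 / (2 * a) * ∑ i, (Y i x + μ i) ^ 2 := by positivity
    linarith
  have hmk := mul_meas_ge_le_integral_of_nonneg
    (Filter.Eventually.of_forall fun x => (Real.exp_pos _).le : 0 ≤ᵐ[P] φ) hφi (Real.exp (-(r / 2)))
  have hsub : {x | ∑ i, (Y i x + μ i) ^ 2 < r * a} ⊆ {x | Real.exp (-(r / 2)) ≤ φ x} := by
    intro x hx
    simp only [Set.mem_ofPred_eq, hφ] at hx ⊢
    apply Real.exp_le_exp.2
    have h : 1 / (2 * a) * ∑ i, (Y i x + μ i) ^ 2 ≤ 1 / (2 * a) * (r * a) :=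
      mul_le_mul_of_nonneg_left hx.le (by positivity)
    have h' : 1 / (2 * a) * (r * a) = r / 2 := by field_simp
    linarith
  have h1 : P.real {x | ∑ i, (Y i x + μ i) ^ 2 < r * a}
      ≤ P.real {x | Real.exp (-(r / 2)) ≤ φ x} := measureReal_mono hsub
  have h2 := hY.integral_exp_neg_le μ ha hv
  have h3 : Real.exp (-(r / 2)) * P.real {x | Real.exp (-(r / 2)) ≤ φ x}
      ≤ (√2)⁻¹ ^ Fintype.card κ := hmk.trans h2
  calc P.real {x | ∑ i, (Y i x + μ i) ^ 2 < r * a}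
      ≤ Real.exp (r / 2) * (Real.exp (-(r / 2)) * P.real {x | Real.exp (-(r / 2)) ≤ φ x}) := by
        rw [← mul_assoc, ← Real.exp_add]; simpa using h1
    _ ≤ _ := mul_le_mul_of_nonneg_left h3 (Real.exp_pos _).le

/-- The exponential moment of the squared norm of a Gaussian vector, at the parameter `1 / (4 b)`:
half of the critical one. -/
lemma IsCentredGaussian.lintegral_exp_le (hY : IsCentredGaussian P Y v) {b : ℝ}
    (hb : 0 < b) (hv : ∀ w, v w ≤ b * ∑ i, w i ^ 2) :
    ∫⁻ x, ENNReal.ofReal (Real.exp (1 / (4 * b) * ∑ i, Y i x ^ 2)) ∂P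
      ≤ ENNReal.ofReal (√2 ^ Fintype.card κ) := by
  set c : ℝ := (√(2 * b))⁻¹ with hc
  have hc2 : c ^ 2 = 1 / (2 * b) := by rw [hc, inv_pow, Real.sq_sqrt (by positivity), one_div]
  have hleft : ∀ x, ENNReal.ofReal (Real.exp (1 / (4 * b) * ∑ i, Y i x ^ 2))
      = ∫⁻ g, ENNReal.ofReal (Real.exp (c * ∑ i, g i * Y i x)) ∂(stdNormal κ) := by
    intro x
    rw [lintegral_exp_stdNormal c fun i => Y i x, hc2]
    congr 3
    field_simp
    norm_num
  simp_rw [hleft]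
  rw [lintegral_lintegral_swap]
  swap
  · have h1 : ∀ i, AEMeasurable (fun z : Ω × (κ → ℝ) => Y i z.1) (P.prod (stdNormal κ)) :=
      fun i => (hY.aemeasurable i).comp_fst
    have h2 : ∀ i, AEMeasurable (fun z : Ω × (κ → ℝ) => z.2 i) (P.prod (stdNormal κ)) :=
      fun i => ((measurable_pi_apply i).comp measurable_snd).aemeasurable
    have h3 : AEMeasurable (fun z : Ω × (κ → ℝ) => c * ∑ i, z.2 i * Y i z.1)
        (P.prod (stdNormal κ)) :=
      (Finset.aemeasurable_fun_sum _ fun i _ => (h2 i).mul (h1 i)).const_mul _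
    exact ENNReal.measurable_ofReal.comp_aemeasurable (Real.measurable_exp.comp_aemeasurable h3)
  have hright : ∀ g : κ → ℝ, ∫⁻ x, ENNReal.ofReal (Real.exp (c * ∑ i, g i * Y i x)) ∂P
      ≤ ENNReal.ofReal (Real.exp (-(-(1 / 4)) * ∑ i, g i ^ 2)) := by
    intro g
    have hm : Measurable fun y : ℝ => ENNReal.ofReal (Real.exp (c * y)) :=
      ENNReal.measurable_ofReal.comp (Real.measurable_exp.comp (measurable_const.mul measurable_id))
    have h0 : ∫⁻ x, ENNReal.ofReal (Real.exp (c * ∑ i, g i * Y i x)) ∂P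
        = ∫⁻ y, ENNReal.ofReal (Real.exp (c * y)) ∂(P.map fun x => ∑ i, g i * Y i x) := by
      rw [lintegral_map' hm.aemeasurable (hY.aemeasurable_sum g)]
    rw [h0, hY.map_eq, ← ofReal_integral_eq_lintegral_ofReal
      (integrable_exp_mul_gaussianReal c)
      (Filter.Eventually.of_forall fun y => (Real.exp_pos _).le)]
    apply ENNReal.ofReal_le_ofReal
    have h1 := mgf_gaussianReal (p := gaussianReal 0 (v g).toNNReal) (X := id) (μ := 0)
      (v := (v g).toNNReal) (by simp) c
    simp only [mgf, id] at h1
    rw [h1]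
    apply Real.exp_le_exp.2
    rw [Real.coe_toNNReal _ (hY.nonneg g), hc2]
    have h4 : v g * (1 / (2 * b)) ≤ (1 / 2) * ∑ i, g i ^ 2 := by
      rw [mul_one_div, div_le_iff₀ (by positivity)]
      nlinarith [hv g]
    linarith
  calc ∫⁻ g, ∫⁻ x, ENNReal.ofReal (Real.exp (c * ∑ i, g i * Y i x)) ∂P ∂(stdNormal κ)
      ≤ ∫⁻ g, ENNReal.ofReal (Real.exp (-(-(1 / 4)) * ∑ i, g i ^ 2)) ∂(stdNormal κ) :=
        lintegral_mono hright
    _ = ENNReal.ofReal (√2 ^ Fintype.card κ) := by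
        rw [← ofReal_integral_eq_lintegral_ofReal
          (integrable_exp_neg_mul_sum_sq_stdNormal (by norm_num))
          (Filter.Eventually.of_forall fun y => (Real.exp_pos _).le),
          integral_exp_neg_mul_sum_sq_stdNormal (by norm_num)]
        congr 2
        rw [← Real.sqrt_inv]
        norm_num

/-- Upper tail of the squared norm of a Gaussian vector. -/
lemma IsCentredGaussian.measureReal_le_sum_sq (hY : IsCentredGaussian P Y v) {b : ℝ}
    (hb : 0 < b) (hv : ∀ w, v w ≤ b * ∑ i, w i ^ 2) (r : ℝ) :
    P.real {x | r * b ≤ ∑ i, Y i x ^ 2} ≤ Real.exp (-(r / 4)) * √2 ^ Fintype.card κ := by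
  set φ : Ω → ENNReal := fun x => ENNReal.ofReal (Real.exp (1 / (4 * b) * ∑ i, Y i x ^ 2)) with hφ
  have hφm : AEMeasurable φ P := by
    have h1 : AEMeasurable (fun x => ∑ i, Y i x ^ 2) P :=
      Finset.aemeasurable_fun_sum _ fun i _ => (hY.aemeasurable i).pow_const _
    exact ENNReal.measurable_ofReal.comp_aemeasurable
      (Real.measurable_exp.comp_aemeasurable (h1.const_mul _))
  have hmk := mul_meas_ge_le_lintegral₀ hφm (ENNReal.ofReal (Real.exp (r / 4)))
  have hsub : {x | r * b ≤ ∑ i, Y i x ^ 2} ⊆ {x | ENNReal.ofReal (Real.exp (r / 4)) ≤ φ x} := by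
    intro x hx
    simp only [Set.mem_ofPred_eq, hφ] at hx ⊢
    apply ENNReal.ofReal_le_ofReal
    apply Real.exp_le_exp.2
    have h : 1 / (4 * b) * (r * b) ≤ 1 / (4 * b) * ∑ i, Y i x ^ 2 :=
      mul_le_mul_of_nonneg_left hx (by positivity)
    have h' : 1 / (4 * b) * (r * b) = r / 4 := by field_simp
    linarith
  have h3 : ENNReal.ofReal (Real.exp (r / 4)) * P {x | r * b ≤ ∑ i, Y i x ^ 2}
      ≤ ENNReal.ofReal (√2 ^ Fintype.card κ) :=
    ((mul_le_mul_right (measure_mono hsub) _).trans hmk).trans (hY.lintegral_exp_le hb hv)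
  have h4 : Real.exp (r / 4) * P.real {x | r * b ≤ ∑ i, Y i x ^ 2} ≤ √2 ^ Fintype.card κ := by
    have h5 := ENNReal.toReal_mono ENNReal.ofReal_ne_top h3
    rwa [ENNReal.toReal_mul, ENNReal.toReal_ofReal (Real.exp_pos _).le,
      ENNReal.toReal_ofReal (by positivity)] at h5
  calc P.real {x | r * b ≤ ∑ i, Y i x ^ 2}
      = Real.exp (-(r / 4)) * (Real.exp (r / 4) * P.real {x | r * b ≤ ∑ i, Y i x ^ 2}) := by
        rw [← mul_assoc, ← Real.exp_add]; simp
    _ ≤ _ := mul_le_mul_of_nonneg_left h4 (Real.exp_pos _).le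

end Vector

/-! ### Maurey's empirical method -/

section Maurey

variable {κ ι : Type*} [Fintype κ] [Fintype ι]

/-- The quadratic form `y ↦ ‖B y‖² - c ‖y‖²`. -/
def excessForm (B : Matrix κ ι ℝ) (c : ℝ) (y : ι → ℝ) : ℝ :=
  ∑ r, (B *ᵥ y) r ^ 2 - c * ∑ j, y j ^ 2

lemma excessForm_smul (B : Matrix κ ι ℝ) (c t : ℝ) (y : ι → ℝ) :
    excessForm B c (t • y) = t ^ 2 * excessForm B c y := by
  simp only [excessForm, Matrix.mulVec_smul, Pi.smul_apply, smul_eq_mul, mul_pow,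
    ← Finset.mul_sum]
  ring

/-- A quadratic form averaged over a random displacement `ξ`: the mean `q (y + ξ)` is
`q (y + 𝔼 ξ)` plus the variance term `𝔼 q ξ - q (𝔼 ξ)`. -/
lemma sum_mul_excessForm_add {σ : Type*} [Fintype σ] (B : Matrix κ ι ℝ) (c : ℝ) (π : σ → ℝ)
    (hπ : ∑ a, π a = 1) (ξ : σ → ι → ℝ) (y : ι → ℝ) :
    ∑ a, π a * excessForm B c (y + ξ a) =
      excessForm B c (y + ∑ a, π a • ξ a) - excessForm B c (∑ a, π a • ξ a)
        + ∑ a, π a * excessForm B c (ξ a) := by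
  have scalar : ∀ (u : ℝ) (f : σ → ℝ), ∑ a, π a * (u + f a) ^ 2
      = (u + ∑ a, π a * f a) ^ 2 - (∑ a, π a * f a) ^ 2 + ∑ a, π a * f a ^ 2 := by
    intro u f
    have h : ∀ a, π a * (u + f a) ^ 2 = u ^ 2 * π a + 2 * u * (π a * f a) + π a * f a ^ 2 :=
      fun a => by ring
    simp_rw [h, Finset.sum_add_distrib, ← Finset.mul_sum, hπ]
    ring
  have hB : ∀ r, (B *ᵥ (∑ a, π a • ξ a)) r = ∑ a, π a * (B *ᵥ ξ a) r := by
    intro r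
    rw [Matrix.mulVec_sum]
    simp [Matrix.mulVec_smul]
  have hc : ∀ j, (∑ a, π a • ξ a) j = ∑ a, π a * ξ a j := by
    intro j
    simp
  have key : ∀ g : σ → ι → ℝ, ∑ a, π a * excessForm B c (g a)
      = ∑ r, ∑ a, π a * (B *ᵥ g a) r ^ 2 - c * ∑ j, ∑ a, π a * g a j ^ 2 := by
    intro g
    simp only [excessForm, mul_sub, Finset.sum_sub_distrib, Finset.mul_sum]
    congr 1
    · exact Finset.sum_comm
    · rw [Finset.sum_comm]
      exact Finset.sum_congr rfl fun j _ => Finset.sum_congr rfl fun a _ => by ring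
  rw [key, key]
  simp only [excessForm, Matrix.mulVec_add, Pi.add_apply, hB, hc, scalar,
    Finset.sum_add_distrib, Finset.sum_sub_distrib]
  ring

/-- If a quadratic form is at least `c'` at `y` plus any sum of `s` atoms `ξ a`, then averaging over
independent atoms drawn with weights `π` bounds it at `y` plus `s` times their barycentre, up to `s`
times the variance term. -/
lemma le_excessForm_of_forall_sum {σ : Type*} [Fintype σ] (B : Matrix κ ι ℝ) (c : ℝ) (π : σ → ℝ)
    (hπ0 : ∀ a, 0 ≤ π a) (hπ : ∑ a, π a = 1) (ξ : σ → ι → ℝ) (c' : ℝ) (s : ℕ) :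
    ∀ y : ι → ℝ, (∀ J : Fin s → σ, c' ≤ excessForm B c (y + ∑ i, ξ (J i))) →
      c' ≤ excessForm B c (y + (s : ℝ) • ∑ a, π a • ξ a)
        + s * (∑ a, π a * excessForm B c (ξ a) - excessForm B c (∑ a, π a • ξ a)) := by
  induction s with
  | zero => intro y h; simpa using h Fin.elim0
  | succ s ih =>
    intro y h
    have h1 : ∀ a, c' ≤ excessForm B c ((y + (s : ℝ) • ∑ a, π a • ξ a) + ξ a)
        + s * (∑ a, π a * excessForm B c (ξ a) - excessForm B c (∑ a, π a • ξ a)) := by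
      intro a
      have := ih (y + ξ a) fun J => by
        have := h (Fin.cons a J)
        rwa [Fin.sum_univ_succ, Fin.cons_zero, ← add_assoc] at this
      rwa [add_right_comm] at this
    have h2 : ∑ a, π a * c' ≤ ∑ a, π a * (excessForm B c ((y + (s : ℝ) • ∑ a, π a • ξ a) + ξ a)
        + s * (∑ a, π a * excessForm B c (ξ a) - excessForm B c (∑ a, π a • ξ a))) :=
      Finset.sum_le_sum fun a _ => mul_le_mul_of_nonneg_left (h1 a) (hπ0 a)
    simp_rw [mul_add (π _)] at h2
    rw [Finset.sum_add_distrib, ← Finset.sum_mul, ← Finset.sum_mul, hπ, one_mul, one_mul,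
      sum_mul_excessForm_add B c π hπ ξ] at h2
    have h3 : y + ((s + 1 : ℕ) : ℝ) • ∑ a, π a • ξ a
        = y + (s : ℝ) • ∑ a, π a • ξ a + ∑ a, π a • ξ a := by
      push_cast
      rw [add_smul, one_smul, add_assoc]
    rw [h3]
    push_cast
    linarith

/-- Restricted strong convexity follows columnwise from a lower bound on `‖B v‖²`. -/
lemma frobSq_mul_ge (B : Matrix κ ι ℝ) {c K : ℝ} (hK : 0 ≤ K)
    (h : ∀ v : ι → ℝ, c * ∑ j, v j ^ 2 - K * (∑ j, |v j|) ^ 2 ≤ ∑ r, (B *ᵥ v) r ^ 2)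
    (D : Matrix ι ι ℝ) :
    c * frobSq D - K * elemL1 D ^ 2 ≤ frobSq (B * D) := by
  have h1 : frobSq (B * D) = ∑ k, ∑ r, (B *ᵥ fun j => D j k) r ^ 2 := by
    rw [frobSq, Finset.sum_comm]
    rfl
  have h2 : frobSq D = ∑ k, ∑ j, D j k ^ 2 := by rw [frobSq, Finset.sum_comm]
  have h3 : ∑ k, (∑ j, |D j k|) ^ 2 ≤ elemL1 D ^ 2 := by
    rw [elemL1, Finset.sum_comm]
    exact Finset.sum_sq_le_sq_sum_of_nonneg fun k _ => Finset.sum_nonneg fun j _ => abs_nonneg _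
  have h4 := Finset.sum_le_sum fun k (_ : k ∈ Finset.univ) => h fun j => D j k
  rw [Finset.sum_sub_distrib, ← Finset.mul_sum, ← Finset.mul_sum, ← h1, ← h2] at h4
  have h5 := mul_le_mul_of_nonneg_left h3 hK
  linarith

variable [DecidableEq ι]

/-- The sum of the signed unit vectors listed by `J`; these are the vectors that approximate an
arbitrary vector in Maurey's method. -/
def signedSum {s : ℕ} (J : Fin s → ι × Bool) : ι → ℝ :=
  ∑ i, (if (J i).2 then (1 : ℝ) else -1) • Pi.single (J i).1 (1 : ℝ)

/-- A lower bound for a quadratic form on sums of `s` signed unit vectors extends to all vectors,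
at the price of an `ℓ₁` term of order `1 / s`. -/
theorem sum_mulVec_sq_ge_of_signedSum (B : Matrix κ ι ℝ) {c K : ℝ} (hc : 0 ≤ c) {s : ℕ}
    (hs : 1 ≤ s)
    (hJ : ∀ J : Fin s → ι × Bool,
      c * ∑ j, signedSum J j ^ 2 ≤ ∑ r, (B *ᵥ signedSum J) r ^ 2)
    (hK : ∀ j, ∑ r, B r j ^ 2 ≤ K) (v : ι → ℝ) :
    c * ∑ j, v j ^ 2 - K / s * (∑ j, |v j|) ^ 2 ≤ ∑ r, (B *ᵥ v) r ^ 2 := by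
  have hs0 : (0 : ℝ) < s := by exact_mod_cast hs
  set L := ∑ j, |v j| with hL
  have hL0 : 0 ≤ L := Finset.sum_nonneg fun j _ => abs_nonneg _
  rcases hL0.eq_or_lt with hL00 | hLpos
  · have hv : v = 0 := by
      ext j
      have := (Finset.sum_eq_zero_iff_of_nonneg fun j _ => abs_nonneg (v j)).1 hL00.symm j
        (Finset.mem_univ j)
      simpa using this
    rw [← hL00, hv]
    simp
  -- The atom `± e_j` is drawn with probability `v_j^± / L`.
  let π : ι × Bool → ℝ := fun a => (if a.2 then max (v a.1) 0 else max (-v a.1) 0) / L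
  let ξ : ι × Bool → ι → ℝ := fun a => (if a.2 then (1 : ℝ) else -1) • Pi.single a.1 (1 : ℝ)
  have hπ0 : ∀ a, 0 ≤ π a := fun a => by
    refine div_nonneg ?_ hL0
    split_ifs <;> exact le_max_right _ _
  have hmax : ∀ t : ℝ, max t 0 + max (-t) 0 = |t| := fun t => by
    rcases le_total 0 t with h | h
    · rw [max_eq_left h, max_eq_right (by linarith), abs_of_nonneg h, add_zero]
    · rw [max_eq_right h, max_eq_left (by linarith), abs_of_nonpos h, zero_add]
  have hmax' : ∀ t : ℝ, max t 0 - max (-t) 0 = t := fun t => by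
    rcases le_total 0 t with h | h
    · rw [max_eq_left h, max_eq_right (by linarith), sub_zero]
    · rw [max_eq_right h, max_eq_left (by linarith)]; ring
  have hπ : ∑ a, π a = 1 := by
    rw [Fintype.sum_prod_type]
    simp only [π, Fintype.sum_bool, if_true, Bool.false_eq_true, if_false, ← add_div, hmax]
    rw [← Finset.sum_div, ← hL, div_self hLpos.ne']
  have hbar : ∑ a, π a • ξ a = L⁻¹ • v := by
    ext j
    rw [Finset.sum_apply, Fintype.sum_prod_type]
    simp only [π, ξ, Fintype.sum_bool, if_true, Bool.false_eq_true, if_false, Pi.smul_apply,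
      smul_eq_mul]
    rw [Finset.sum_eq_single j]
    · rw [Pi.single_eq_same]
      linear_combination L⁻¹ * hmax' (v j)
    · intro i _ hij
      simp [Pi.single_eq_of_ne' hij]
    · simp
  have hatom : ∀ a, excessForm B c (ξ a) ≤ K - c := by
    intro a
    have h1 : excessForm B c (ξ a) = ∑ r, B r a.1 ^ 2 - c := by
      simp only [ξ, excessForm_smul]
      have : (if a.2 = true then (1 : ℝ) else -1) ^ 2 = 1 := by split_ifs <;> norm_num
      rw [this, one_mul, excessForm]
      simp [Pi.single_apply]
    rw [h1]
    linarith [hK a.1]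
  have hmean : ∑ a, π a * excessForm B c (ξ a) ≤ K - c := by
    calc ∑ a, π a * excessForm B c (ξ a) ≤ ∑ a, π a * (K - c) :=
          Finset.sum_le_sum fun a _ => mul_le_mul_of_nonneg_left (hatom a) (hπ0 a)
      _ = K - c := by rw [← Finset.sum_mul, hπ, one_mul]
  have hmain := le_excessForm_of_forall_sum B c π hπ0 hπ ξ 0 s 0 fun J => by
    have := hJ J
    rw [zero_add]
    simp only [excessForm]
    simp only [signedSum] at this
    linarith
  rw [zero_add, hbar, excessForm_smul, excessForm_smul] at hmain
  have h2 : 0 ≤ s * ((s : ℝ) * (L⁻¹ ^ 2 * excessForm B c v) + (K - c)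
      - L⁻¹ ^ 2 * excessForm B c v) := by
    have := mul_le_mul_of_nonneg_left hmean hs0.le
    linarith
  have h3 : 0 ≤ (s : ℝ) * (L⁻¹ ^ 2 * excessForm B c v) + (K - c)
      - L⁻¹ ^ 2 * excessForm B c v := nonneg_of_mul_nonneg_right h2 hs0
  have h4 : 0 ≤ ((s : ℝ) - 1) * excessForm B c v + L ^ 2 * (K - c) := by
    have h5 := mul_nonneg (sq_nonneg L) h3
    have h6 : L ^ 2 * ((s : ℝ) * (L⁻¹ ^ 2 * excessForm B c v) + (K - c)
      - L⁻¹ ^ 2 * excessForm B c v) = ((s : ℝ) - 1) * excessForm B c v + L ^ 2 * (K - c) := by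
      field_simp
      ring
    linarith
  have h7 : -(c * L ^ 2) ≤ excessForm B c v := by
    have h8 : ∑ j, v j ^ 2 ≤ L ^ 2 := by
      have := Finset.sum_sq_le_sq_sum_of_nonneg (s := Finset.univ) (f := fun j => |v j|)
        (fun j _ => abs_nonneg _)
      simpa using this
    have h9 : 0 ≤ ∑ r, (B *ᵥ v) r ^ 2 := Finset.sum_nonneg fun r _ => sq_nonneg _
    have h10 := mul_le_mul_of_nonneg_left h8 hc
    simp only [excessForm]
    linarith
  have h11 : -(L ^ 2 * K) ≤ s * excessForm B c v := by linarith
  have h12 : -(K / s * L ^ 2) ≤ excessForm B c v := by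
    have h13 : -(K / s * L ^ 2) = -(L ^ 2 * K) / s := by ring
    rw [h13, div_le_iff₀ hs0]
    linarith
  simp only [excessForm] at h12
  linarith

end Maurey

/-! ### Extreme eigenvalues -/

section Eigenvalues

open scoped ComplexOrder

variable {𝕜 ι : Type*} [RCLike 𝕜] [Fintype ι] [DecidableEq ι]

lemma Matrix.IsHermitian.finite_spectrum_real {M : Matrix ι ι 𝕜} (hM : M.IsHermitian) :
    (spectrum ℝ M).Finite := by
  rw [hM.spectrum_real_eq_range_eigenvalues]
  exact Set.finite_range _

lemma Matrix.IsHermitian.posSemidef_of_spectrum_nonneg {M : Matrix ι ι 𝕜} (hM : M.IsHermitian)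
    (h : ∀ k ∈ spectrum ℝ M, 0 ≤ k) : M.PosSemidef :=
  hM.posSemidef_iff_eigenvalues_nonneg.2 fun i => h _ (hM.eigenvalues_mem_spectrum_real i)

lemma isHermitian_algebraMap_real (c : ℝ) :
    (algebraMap ℝ (Matrix ι ι 𝕜) c).IsHermitian := by
  rw [Algebra.algebraMap_eq_smul_one]
  ext i j
  simp only [Matrix.conjTranspose_apply, Matrix.smul_apply, star_smul, star_trivial]
  rw [← Matrix.conjTranspose_apply, Matrix.conjTranspose_one]

lemma re_dotProduct_algebraMap_real_mulVec (c : ℝ) (x : ι → 𝕜) :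
    RCLike.re (star x ⬝ᵥ (algebraMap ℝ (Matrix ι ι 𝕜) c *ᵥ x)) = c * ∑ i, ‖x i‖ ^ 2 := by
  rw [Algebra.algebraMap_eq_smul_one, Matrix.smul_mulVec, Matrix.one_mulVec, dotProduct_smul,
    RCLike.smul_re, dotProduct, map_sum]
  congr 1
  refine Finset.sum_congr rfl fun i _ => ?_
  rw [Pi.star_apply, RCLike.star_def, RCLike.conj_mul]
  norm_cast

lemma lambdaMin_mul_le {M : Matrix ι ι 𝕜} (hM : M.IsHermitian) (x : ι → 𝕜) :
    lambdaMin M * ∑ i, ‖x i‖ ^ 2 ≤ RCLike.re (star x ⬝ᵥ (M *ᵥ x)) := by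
  have h : (M - algebraMap ℝ (Matrix ι ι 𝕜) (lambdaMin M)).PosSemidef := by
    refine (hM.sub (isHermitian_algebraMap_real _)).posSemidef_of_spectrum_nonneg fun k hk => ?_
    rw [← spectrum.sub_singleton_eq, Set.sub_singleton] at hk
    obtain ⟨l, hl, rfl⟩ := hk
    exact sub_nonneg.2 (csInf_le hM.finite_spectrum_real.bddBelow hl)
  have := h.re_dotProduct_nonneg x
  rw [Matrix.sub_mulVec, dotProduct_sub, map_sub, re_dotProduct_algebraMap_real_mulVec] at this
  linarith

lemma le_lambdaMax_mul {M : Matrix ι ι 𝕜} (hM : M.IsHermitian) (x : ι → 𝕜) :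
    RCLike.re (star x ⬝ᵥ (M *ᵥ x)) ≤ lambdaMax M * ∑ i, ‖x i‖ ^ 2 := by
  have h : (algebraMap ℝ (Matrix ι ι 𝕜) (lambdaMax M) - M).PosSemidef := by
    refine ((isHermitian_algebraMap_real _).sub hM).posSemidef_of_spectrum_nonneg fun k hk => ?_
    rw [← spectrum.singleton_sub_eq, Set.singleton_sub] at hk
    obtain ⟨l, hl, rfl⟩ := hk
    exact sub_nonneg.2 (le_csSup hM.finite_spectrum_real.bddAbove hl)
  have := h.re_dotProduct_nonneg x
  rw [Matrix.sub_mulVec, dotProduct_sub, map_sub, re_dotProduct_algebraMap_real_mulVec] at this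
  linarith

/-- A uniform bound on the entries bounds the spectrum uniformly. -/
lemma exists_abs_le_of_mem_spectrum (c : ℝ) :
    ∃ K : ℝ, 0 ≤ K ∧ ∀ M : Matrix ι ι 𝕜, (∀ i j, ‖M i j‖ ≤ c) → ∀ k ∈ spectrum ℝ M, |k| ≤ K := by
  let _ : NormedRing (Matrix ι ι 𝕜) := Matrix.linftyOpNormedRing
  let _ : NormedAlgebra ℝ (Matrix ι ι 𝕜) := Matrix.linftyOpNormedAlgebra
  refine ⟨(Fintype.card ι * c.toNNReal : ℝ) * ‖(1 : Matrix ι ι 𝕜)‖, by positivity,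
    fun M hM k hk => ?_⟩
  have h1 := spectrum.norm_le_norm_mul_of_mem hk
  refine h1.trans (mul_le_mul_of_nonneg_right ?_ (norm_nonneg _))
  rw [Matrix.linfty_opNorm_def]
  have h2 : (Finset.univ.sup fun i => ∑ j, ‖M i j‖₊) ≤ Fintype.card ι * c.toNNReal := by
    refine Finset.sup_le fun i _ => ?_
    calc ∑ j, ‖M i j‖₊ ≤ ∑ _j : ι, c.toNNReal :=
          Finset.sum_le_sum fun j _ => NNReal.le_toNNReal_of_coe_le (hM i j)
      _ = _ := by simp
  exact_mod_cast h2

lemma abs_lambdaMax_le {M : Matrix ι ι 𝕜} {K : ℝ} (hK : 0 ≤ K)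
    (h : ∀ k ∈ spectrum ℝ M, |k| ≤ K) : |lambdaMax M| ≤ K := by
  rcases (spectrum ℝ M).eq_empty_or_nonempty with h0 | ⟨k, hk⟩
  · simpa [lambdaMax, h0] using hK
  · exact abs_le.2 ⟨(abs_le.1 (h k hk)).1.trans
      (le_csSup ⟨K, fun l hl => (abs_le.1 (h l hl)).2⟩ hk),
      csSup_le ⟨k, hk⟩ fun l hl => (abs_le.1 (h l hl)).2⟩

lemma abs_lambdaMin_le {M : Matrix ι ι 𝕜} {K : ℝ} (hK : 0 ≤ K)
    (h : ∀ k ∈ spectrum ℝ M, |k| ≤ K) : |lambdaMin M| ≤ K := by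
  rcases (spectrum ℝ M).eq_empty_or_nonempty with h0 | ⟨k, hk⟩
  · simpa [lambdaMin, h0] using hK
  · exact abs_le.2 ⟨le_csInf ⟨k, hk⟩ fun l hl => (abs_le.1 (h l hl)).1,
      (csInf_le ⟨-K, fun l hl => (abs_le.1 (h l hl)).1⟩ hk).trans (abs_le.1 (h k hk)).2⟩

end Eigenvalues

/-! ### Stable matrices and Fourier inversion -/

/-- The powers of a stable matrix are summable, by Gelfand's formula. -/
lemma summable_norm_pow_apply_of_stable {ι : Type*} [Fintype ι] [DecidableEq ι]
    {A : Matrix ι ι ℝ}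
    (hA : ∀ z : ℂ, ‖z‖ ≤ 1 → (1 - z • A.map (fun a : ℝ => (a : ℂ))).det ≠ 0) (i j : ι) :
    Summable fun k : ℕ => |(A ^ k) i j| := by
  let _ : NormedRing (Matrix ι ι ℂ) := Matrix.linftyOpNormedRing
  let _ : NormedAlgebra ℂ (Matrix ι ι ℂ) := Matrix.linftyOpNormedAlgebra
  have _ : Nonempty ι := ⟨i⟩
  set B : Matrix ι ι ℂ := A.map (fun a : ℝ => (a : ℂ)) with hB
  have hpow : ∀ k, (B ^ k) i j = (((A ^ k) i j : ℝ) : ℂ) := by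
    intro k
    have h := Matrix.map_pow A Complex.ofRealHom k
    exact (congrFun (congrFun h i) j).symm
  have hspec : spectralRadius ℂ B < (1 : NNReal) := by
    refine spectrum.spectralRadius_lt_of_forall_lt B fun z hz => ?_
    by_contra hlt
    have h1 : 1 ≤ ‖z‖ := by exact_mod_cast not_lt.1 hlt
    have hz0 : z ≠ 0 := by rintro rfl; simp at h1; linarith
    rw [spectrum.mem_iff, Matrix.isUnit_iff_isUnit_det, isUnit_iff_ne_zero, not_not] at hz
    refine hA z⁻¹ (by rw [norm_inv]; exact inv_le_one_of_one_le₀ h1) ?_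
    have h2 : (1 : Matrix ι ι ℂ) - z⁻¹ • B = z⁻¹ • (algebraMap ℂ (Matrix ι ι ℂ) z - B) := by
      rw [smul_sub, Algebra.algebraMap_eq_smul_one, smul_smul, inv_mul_cancel₀ hz0, one_smul]
    rw [h2, Matrix.det_smul, hz, mul_zero]
  obtain ⟨r, hr1, hr2⟩ := ENNReal.lt_iff_exists_nnreal_btwn.1 hspec
  have hev := (spectrum.pow_nnnorm_pow_one_div_tendsto_nhds_spectralRadius B).eventually
    (gt_mem_nhds hr1)
  have hr2' : (r : ℝ) < 1 := by exact_mod_cast hr2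
  refine Summable.of_norm_bounded_eventually_nat
    (summable_geometric_of_lt_one r.coe_nonneg hr2') ?_
  filter_upwards [hev, Filter.eventually_gt_atTop 0] with k hk hk0
  have h3 : (‖B ^ k‖₊ : ENNReal) ≤ (r : ENNReal) ^ k := by
    have h4 := ENNReal.rpow_le_rpow hk.le (z := (k : ℝ)) (by positivity)
    rw [← ENNReal.rpow_mul, one_div, inv_mul_cancel₀ (by exact_mod_cast hk0.ne'),
      ENNReal.rpow_one, ENNReal.rpow_natCast] at h4
    exact h4
  have h5 : ‖B ^ k‖ ≤ (r : ℝ) ^ k := by exact_mod_cast h3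
  have h6 : ‖(B ^ k) i j‖₊ ≤ ‖B ^ k‖₊ := by
    rw [Matrix.linfty_opNNNorm_def]
    exact (Finset.single_le_sum (f := fun j => ‖(B ^ k) i j‖₊) (fun _ _ => zero_le)
      (Finset.mem_univ j)).trans (Finset.le_sup (f := fun i => ∑ j, ‖(B ^ k) i j‖₊)
      (Finset.mem_univ i))
  have h7 : ‖(B ^ k) i j‖ ≤ ‖B ^ k‖ := by exact_mod_cast h6
  rw [hpow, Complex.norm_real] at h7
  simp only [Real.norm_eq_abs, abs_abs] at h7 ⊢
  exact h7.trans h5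

lemma integral_cexp_int (h : ℤ) :
    ∫ θ in Set.Icc (-Real.pi) Real.pi, Complex.exp (Complex.I * (θ : ℂ) * (h : ℂ))
      = if h = 0 then 2 * (Real.pi : ℂ) else 0 := by
  rw [integral_Icc_eq_integral_Ioc, ← intervalIntegral.integral_of_le (by linarith [Real.pi_pos])]
  split_ifs with h0
  · subst h0
    simp
    ring
  · have h1 : ∀ θ : ℝ, Complex.I * (θ : ℂ) * (h : ℂ) = (Complex.I * h) * θ := fun θ => by ring
    simp_rw [h1]
    have h2 : Complex.I * (h : ℂ) ≠ 0 := mul_ne_zero Complex.I_ne_zero (by exact_mod_cast h0)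
    rw [integral_exp_mul_complex h2, div_eq_zero_iff]
    left
    rw [sub_eq_zero, Complex.exp_eq_exp_iff_exists_int]
    exact ⟨h, by push_cast; ring⟩

lemma norm_cexp_I_mul_int (θ : ℝ) (h : ℤ) :
    ‖Complex.exp (Complex.I * (θ : ℂ) * (h : ℂ))‖ = 1 := by
  have : Complex.I * (θ : ℂ) * (h : ℂ) = ((θ * h : ℝ) : ℂ) * Complex.I := by push_cast; ring
  rw [this, Complex.norm_exp_ofReal_mul_I]

/-- The scalar spectral density of an autocovariance sequence `γ`. -/
noncomputable def scalarSpectralDensity (γ : ℤ → ℝ) (θ : ℝ) : ℂ :=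
  1 / (2 * (Real.pi : ℂ)) * ∑' h : ℤ, (γ h : ℂ) * Complex.exp (Complex.I * (θ : ℂ) * (h : ℂ))

lemma continuous_scalarSpectralDensity {γ : ℤ → ℝ} (hγ : Summable fun h => |γ h|) :
    Continuous (scalarSpectralDensity γ) := by
  refine continuous_const.mul (continuous_tsum (fun h => by fun_prop) hγ fun h θ => ?_)
  rw [norm_mul, norm_cexp_I_mul_int, mul_one, Complex.norm_real, Real.norm_eq_abs]

lemma integral_scalarSpectralDensity_mul {γ : ℤ → ℝ} (hγ : Summable fun h => |γ h|) (k : ℤ) :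
    ∫ θ in Set.Icc (-Real.pi) Real.pi,
      scalarSpectralDensity γ θ * Complex.exp (Complex.I * (θ : ℂ) * ((-k : ℤ) : ℂ)) = γ k := by
  have hpi : (Real.pi : ℂ) ≠ 0 := by exact_mod_cast Real.pi_ne_zero
  set F : ℤ → ℝ → ℂ := fun h θ =>
    (γ h : ℂ) * Complex.exp (Complex.I * (θ : ℂ) * ((h - k : ℤ) : ℂ)) with hF
  have hFi : ∀ h, Integrable (F h) (volume.restrict (Set.Icc (-Real.pi) Real.pi)) := fun h =>
    (Continuous.continuousOn (by fun_prop)).integrableOn_compact isCompact_Icc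
  have hFn : ∀ h θ, ‖F h θ‖ = |γ h| := fun h θ => by
    rw [hF, norm_mul, norm_cexp_I_mul_int, mul_one, Complex.norm_real, Real.norm_eq_abs]
  have hs := hasSum_integral_of_summable_integral_norm hFi (by
    simp_rw [hFn, integral_const]
    exact hγ.mul_left _)
  have h1 : ∀ h, ∫ θ in Set.Icc (-Real.pi) Real.pi, F h θ
      = if h = k then 2 * (Real.pi : ℂ) * γ k else 0 := by
    intro h
    simp only [hF]
    rw [integral_const_mul, integral_cexp_int]
    by_cases hk : h = k
    · subst hk; simp [mul_comm]
    · simp [hk, sub_eq_zero]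
  simp_rw [h1] at hs
  have h2 := (hasSum_ite_eq k (2 * (Real.pi : ℂ) * γ k)).unique hs
  have h3 : ∀ θ : ℝ, scalarSpectralDensity γ θ *
      Complex.exp (Complex.I * (θ : ℂ) * ((-k : ℤ) : ℂ))
      = 1 / (2 * (Real.pi : ℂ)) * ∑' h, F h θ := by
    intro θ
    rw [scalarSpectralDensity, mul_assoc, ← tsum_mul_right]
    congr 2
    ext h
    simp only [hF]
    rw [mul_assoc, ← Complex.exp_add]
    congr 2
    push_cast
    ring
  simp_rw [h3]
  rw [integral_const_mul, ← h2]
  field_simp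

/-- The quadratic form of a Toeplitz matrix as an integral against the spectral density. -/
lemma sum_toeplitz_eq_integral {γ : ℤ → ℝ} (hγ : Summable fun h => |γ h|) {N : ℕ}
    (w : Fin N → ℝ) :
    ∑ r, ∑ t, w r * w t * γ ((t : ℤ) - (r : ℤ)) =
      ∫ θ in Set.Icc (-Real.pi) Real.pi, (scalarSpectralDensity γ θ).re *
        ‖∑ t, (w t : ℂ) * Complex.exp (Complex.I * (θ : ℂ) * ((t : ℤ) : ℂ))‖ ^ 2 := by
  have hcont := continuous_scalarSpectralDensity hγ
  have hcomplex : ((∑ r, ∑ t, w r * w t * γ ((t : ℤ) - (r : ℤ)) : ℝ) : ℂ) =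
      ∫ θ in Set.Icc (-Real.pi) Real.pi, scalarSpectralDensity γ θ *
        ((‖∑ t, (w t : ℂ) * Complex.exp (Complex.I * (θ : ℂ) * ((t : ℤ) : ℂ))‖ ^ 2 : ℝ) : ℂ) := by
    have h1 : ∀ θ : ℝ, scalarSpectralDensity γ θ *
        ((‖∑ t, (w t : ℂ) * Complex.exp (Complex.I * (θ : ℂ) * ((t : ℤ) : ℂ))‖ ^ 2 : ℝ) : ℂ)
        = ∑ r, ∑ t, (w r * w t : ℂ) * (scalarSpectralDensity γ θ *
          Complex.exp (Complex.I * (θ : ℂ) * ((-((t : ℤ) - (r : ℤ)) : ℤ) : ℂ))) := by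
      intro θ
      rw [Complex.ofReal_pow, ← Complex.mul_conj', map_sum, Finset.sum_mul_sum, Finset.mul_sum]
      refine Finset.sum_congr rfl fun r _ => ?_
      rw [Finset.mul_sum]
      refine Finset.sum_congr rfl fun t _ => ?_
      rw [map_mul, ← Complex.exp_conj, Complex.conj_ofReal]
      simp only [map_mul, Complex.conj_I, Complex.conj_ofReal, map_intCast]
      have h2 : Complex.exp (Complex.I * (θ : ℂ) * ((-((t : ℤ) - (r : ℤ)) : ℤ) : ℂ))
          = Complex.exp (Complex.I * (θ : ℂ) * ((r : ℤ) : ℂ)) *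
            Complex.exp (-Complex.I * (θ : ℂ) * ((t : ℤ) : ℂ)) := by
        rw [← Complex.exp_add]
        congr 1
        push_cast
        ring
      rw [h2]
      ring
    simp_rw [h1]
    have hi : ∀ k : ℤ, ∀ c : ℂ, Integrable (fun θ : ℝ => c * (scalarSpectralDensity γ θ *
        Complex.exp (Complex.I * (θ : ℂ) * (k : ℂ))))
        (volume.restrict (Set.Icc (-Real.pi) Real.pi)) := fun k c =>
      (Continuous.continuousOn (by fun_prop)).integrableOn_compact isCompact_Icc
    rw [integral_finsetSum _ fun r _ => integrable_finsetSum _ fun t _ => hi _ _]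
    simp only [Complex.ofReal_sum, Complex.ofReal_mul]
    refine Finset.sum_congr rfl fun r _ => ?_
    rw [integral_finsetSum _ fun t _ => hi _ _]
    refine Finset.sum_congr rfl fun t _ => ?_
    rw [integral_const_mul, integral_scalarSpectralDensity_mul hγ]
  have hint : Integrable (fun θ : ℝ => scalarSpectralDensity γ θ *
        ((‖∑ t, (w t : ℂ) * Complex.exp (Complex.I * (θ : ℂ) * ((t : ℤ) : ℂ))‖ ^ 2 : ℝ) : ℂ))
        (volume.restrict (Set.Icc (-Real.pi) Real.pi)) :=
    (Continuous.continuousOn (by fun_prop)).integrableOn_compact isCompact_Icc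
  have h3 := congrArg Complex.re hcomplex
  rw [Complex.ofReal_re] at h3
  rw [h3]
  refine (integral_re hint).symm.trans (integral_congr_ae (Filter.Eventually.of_forall fun θ => ?_))
  exact Complex.re_mul_ofReal _ _

lemma integral_norm_trigPoly_sq {N : ℕ} (w : Fin N → ℝ) :
    ∫ θ in Set.Icc (-Real.pi) Real.pi,
      ‖∑ t, (w t : ℂ) * Complex.exp (Complex.I * (θ : ℂ) * ((t : ℤ) : ℂ))‖ ^ 2
      = 2 * Real.pi * ∑ t, w t ^ 2 := by
  have hpi := Real.pi_ne_zero
  -- White noise has constant spectral density `1 / (2π)`.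
  have hγ : Summable fun h : ℤ => |if h = 0 then (1 : ℝ) else 0| := by
    refine summable_of_ne_finset_zero (s := {0}) fun h hh => ?_
    simp only [Finset.mem_singleton] at hh
    simp [hh]
  have h1 := sum_toeplitz_eq_integral hγ w
  have h2 : ∀ θ : ℝ, scalarSpectralDensity (fun h : ℤ => if h = 0 then (1 : ℝ) else 0) θ
      = ((1 / (2 * Real.pi) : ℝ) : ℂ) := by
    intro θ
    rw [scalarSpectralDensity, tsum_eq_single 0]
    · simp
    · intro h hh; simp [hh]
  simp_rw [h2, Complex.ofReal_re] at h1
  rw [integral_const_mul] at h1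
  have h3 : ∑ r, ∑ t, w r * w t * (if ((t : ℤ) - (r : ℤ)) = 0 then (1 : ℝ) else 0)
      = ∑ t, w t ^ 2 := by
    refine Finset.sum_congr rfl fun r _ => ?_
    rw [Finset.sum_eq_single r]
    · simp [sq]
    · intro t _ htr
      have : ((t : ℤ) - (r : ℤ)) ≠ 0 := by
        intro h
        exact htr (Fin.ext (by omega))
      simp [this]
    · simp
  rw [h3] at h1
  rw [h1]
  field_simp

/-- Bounds on the spectral density transfer to every Toeplitz covariance matrix. -/
lemma sum_toeplitz_bounds {γ : ℤ → ℝ} (hγ : Summable fun h => |γ h|) {a b : ℝ}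
    (h : ∀ᵐ θ ∂(volume.restrict (Set.Icc (-Real.pi) Real.pi)),
      a ≤ (scalarSpectralDensity γ θ).re ∧ (scalarSpectralDensity γ θ).re ≤ b)
    {N : ℕ} (w : Fin N → ℝ) :
    2 * Real.pi * a * ∑ t, w t ^ 2 ≤ ∑ r, ∑ t, w r * w t * γ ((t : ℤ) - (r : ℤ)) ∧
      ∑ r, ∑ t, w r * w t * γ ((t : ℤ) - (r : ℤ)) ≤ 2 * Real.pi * b * ∑ t, w t ^ 2 := by
  have hcont := continuous_scalarSpectralDensity hγ
  have hi : Integrable (fun θ : ℝ => (scalarSpectralDensity γ θ).re *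
        ‖∑ t, (w t : ℂ) * Complex.exp (Complex.I * (θ : ℂ) * ((t : ℤ) : ℂ))‖ ^ 2)
        (volume.restrict (Set.Icc (-Real.pi) Real.pi)) :=
    (Continuous.continuousOn ((Complex.continuous_re.comp hcont).mul
      (by fun_prop))).integrableOn_compact isCompact_Icc
  have hi2 : ∀ c : ℝ, Integrable (fun θ : ℝ => c *
        ‖∑ t, (w t : ℂ) * Complex.exp (Complex.I * (θ : ℂ) * ((t : ℤ) : ℂ))‖ ^ 2)
        (volume.restrict (Set.Icc (-Real.pi) Real.pi)) := fun c =>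
    (Continuous.continuousOn (by fun_prop)).integrableOn_compact isCompact_Icc
  have hconst : ∀ c : ℝ, ∫ θ in Set.Icc (-Real.pi) Real.pi, c *
        ‖∑ t, (w t : ℂ) * Complex.exp (Complex.I * (θ : ℂ) * ((t : ℤ) : ℂ))‖ ^ 2
        = 2 * Real.pi * c * ∑ t, w t ^ 2 := fun c => by
    rw [integral_const_mul, integral_norm_trigPoly_sq]
    ring
  rw [sum_toeplitz_eq_integral hγ, ← hconst, ← hconst]
  constructor
  · refine integral_mono_ae (hi2 a) hi ?_
    filter_upwards [h] with θ hθ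
    exact mul_le_mul_of_nonneg_right hθ.1 (sq_nonneg _)
  · refine integral_mono_ae hi (hi2 b) ?_
    filter_upwards [h] with θ hθ
    exact mul_le_mul_of_nonneg_right hθ.2 (sq_nonneg _)

/-! ### Second-order structure of a stable Gaussian VAR(1) process -/

lemma spectralDensity_apply {Ω ι : Type*} [MeasurableSpace Ω] (P : Measure Ω)
    (Z : ℤ → Ω → ι → ℝ) (i j : ι) (θ : ℝ) :
    spectralDensity P Z θ i j = scalarSpectralDensity (fun k => autocov P Z k i j) θ := rfl

namespace IsStableGaussianVAR

variable {Ω ι : Type*} [MeasurableSpace Ω] [Fintype ι] [DecidableEq ι] {P : Measure Ω}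
  {Z W : ℤ → Ω → ι → ℝ} {A Sw : Matrix ι ι ℝ}

lemma hasGaussianLaw_coord (h : IsStableGaussianVAR P Z W A Sw) (t : ℤ) (i : ι) :
    HasGaussianLaw (fun x => Z t x i) P :=
  (h.gaussian.hasGaussianLaw_eval t).map (ContinuousLinearMap.proj (R := ℝ) i)

lemma hasGaussianLaw_noise_coord (h : IsStableGaussianVAR P Z W A Sw) (t : ℤ) (i : ι) :
    HasGaussianLaw (fun x => W t x i) P :=
  (h.noise_gaussian t).map (ContinuousLinearMap.proj (R := ℝ) i)

lemma integrable_mul (h : IsStableGaussianVAR P Z W A Sw) (s t : ℤ) (i j : ι) :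
    Integrable (fun x => Z s x i * Z t x j) P :=
  (h.hasGaussianLaw_coord s i).memLp_two.integrable_mul (h.hasGaussianLaw_coord t j).memLp_two

lemma integral_mul (h : IsStableGaussianVAR P Z W A Sw) (s t : ℤ) (i j : ι) :
    ∫ x, Z s x i * Z t x j ∂P = autocov P Z (t - s) i j := by
  have := h.stationary s (t - s) i j
  rw [add_sub_cancel] at this
  exact this

lemma integral_mul_noise (h : IsStableGaussianVAR P Z W A Sw) {s t : ℤ} (hst : s < t) (i j : ι) :
    ∫ x, Z s x i * W t x j ∂P = 0 := by
  have hind : IndepFun (fun x => Z s x i) (fun x => W t x j) P :=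
    ((h.noise_indep_past s t hst).comp (measurable_pi_apply j) (measurable_pi_apply i)).symm
  rw [hind.integral_fun_mul_eq_mul_integral
    (h.hasGaussianLaw_coord s i).aemeasurable.aestronglyMeasurable
    (h.hasGaussianLaw_noise_coord t j).aemeasurable.aestronglyMeasurable, h.mean_zero, zero_mul]

/-- The Yule-Walker recursion. -/
lemma autocov_succ (h : IsStableGaussianVAR P Z W A Sw) (k : ℕ) :
    autocov P Z ((k + 1 : ℕ) : ℤ) = autocov P Z k * Aᵀ := by
  ext i j
  have h1 : ∫ x, Z 0 x i * Z ((k + 1 : ℕ) : ℤ) x j ∂P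
      = ∫ x, (∑ l, A j l * (Z 0 x i * Z k x l)) + Z 0 x i * W ((k + 1 : ℕ) : ℤ) x j ∂P := by
    refine integral_congr_ae ?_
    filter_upwards [h.dynamics ((k + 1 : ℕ) : ℤ)] with x hx
    rw [hx, show ((k + 1 : ℕ) : ℤ) - 1 = k by push_cast; ring, Pi.add_apply, mul_add,
      Matrix.mulVec, dotProduct, Finset.mul_sum]
    congr 1
    exact Finset.sum_congr rfl fun l _ => by ring
  have h2 : ∀ l, Integrable (fun x => A j l * (Z 0 x i * Z k x l)) P := fun l =>
    (h.integrable_mul 0 k i l).const_mul _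
  have h3 : Integrable (fun x => Z 0 x i * W ((k + 1 : ℕ) : ℤ) x j) P :=
    (h.hasGaussianLaw_coord 0 i).memLp_two.integrable_mul
      (h.hasGaussianLaw_noise_coord _ j).memLp_two
  rw [integral_add (integrable_finsetSum _ fun l _ => h2 l) h3,
    h.integral_mul_noise (by positivity), add_zero, integral_finsetSum _ fun l _ => h2 l] at h1
  simp_rw [integral_const_mul] at h1
  rw [Matrix.mul_apply]
  refine h1.trans (Finset.sum_congr rfl fun l _ => ?_)
  rw [Matrix.transpose_apply, mul_comm]
  rfl

lemma autocov_nat (h : IsStableGaussianVAR P Z W A Sw) (k : ℕ) :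
    autocov P Z k = autocov P Z 0 * (A ^ k)ᵀ := by
  induction k with
  | zero => simp
  | succ k ih => rw [h.autocov_succ, ih, pow_succ', Matrix.transpose_mul, Matrix.mul_assoc]

lemma autocov_neg (h : IsStableGaussianVAR P Z W A Sw) (k : ℤ) (i j : ι) :
    autocov P Z (-k) i j = autocov P Z k j i := by
  have h1 := h.integral_mul (-k) 0 j i
  rw [zero_sub, neg_neg] at h1
  rw [← h1]
  exact integral_congr_ae (Filter.Eventually.of_forall fun x => mul_comm _ _)

lemma summable_autocov (h : IsStableGaussianVAR P Z W A Sw) (i j : ι) :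
    Summable fun k : ℤ => |autocov P Z k i j| := by
  have hnat : ∀ i j, Summable fun k : ℕ => |autocov P Z k i j| := by
    intro i j
    have h1 : ∀ k : ℕ, |autocov P Z k i j|
        ≤ ∑ l, |autocov P Z 0 i l| * |(A ^ k) j l| := by
      intro k
      rw [h.autocov_nat, Matrix.mul_apply]
      refine (Finset.abs_sum_le_sum_abs _ _).trans_eq (Finset.sum_congr rfl fun l _ => ?_)
      rw [abs_mul, Matrix.transpose_apply]
    exact Summable.of_nonneg_of_le (fun _ => abs_nonneg _) h1
      (summable_sum fun l _ => (summable_norm_pow_apply_of_stable h.stable j l).mul_left _)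
  refine Summable.of_nat_of_neg (hnat i j) ?_
  simp_rw [h.autocov_neg]
  exact hnat j i

lemma isHermitian_spectralDensity (h : IsStableGaussianVAR P Z W A Sw) (θ : ℝ) :
    (spectralDensity P Z θ).IsHermitian := by
  ext i j
  rw [Matrix.conjTranspose_apply, spectralDensity_apply, spectralDensity_apply,
    scalarSpectralDensity, scalarSpectralDensity, star_mul', tsum_star,
    ← (Equiv.neg ℤ).tsum_eq]
  congr 1
  · rw [show 1 / (2 * (Real.pi : ℂ)) = ((1 / (2 * Real.pi) : ℝ) : ℂ) by push_cast; rfl,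
      Complex.star_def, Complex.conj_ofReal]
  · refine tsum_congr fun k => ?_
    rw [Equiv.neg_apply, h.autocov_neg, star_mul', Complex.star_def, Complex.conj_ofReal,
      ← Complex.exp_conj]
    simp

lemma exists_norm_spectralDensity_le (h : IsStableGaussianVAR P Z W A Sw) :
    ∃ c : ℝ, ∀ θ i j, ‖spectralDensity P Z θ i j‖ ≤ c := by
  have h1 : ∀ i j θ, ‖spectralDensity P Z θ i j‖
      ≤ ‖1 / (2 * (Real.pi : ℂ))‖ * ∑' k : ℤ, |autocov P Z k i j| := by
    intro i j θ
    rw [spectralDensity_apply, scalarSpectralDensity, norm_mul]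
    refine mul_le_mul_of_nonneg_left ?_ (norm_nonneg _)
    refine tsum_of_norm_bounded (h.summable_autocov i j).hasSum fun k => ?_
    rw [norm_mul, norm_cexp_I_mul_int, mul_one, Complex.norm_real, Real.norm_eq_abs]
  refine ⟨∑ i, ∑ j, ‖1 / (2 * (Real.pi : ℂ))‖ * ∑' k : ℤ, |autocov P Z k i j|,
    fun θ i j => (h1 i j θ).trans ?_⟩
  have h0 : ∀ i j, 0 ≤ ‖1 / (2 * (Real.pi : ℂ))‖ * ∑' k : ℤ, |autocov P Z k i j| := fun i j =>
    mul_nonneg (norm_nonneg _) (tsum_nonneg fun _ => abs_nonneg _)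
  exact (Finset.single_le_sum (f := fun j => ‖1 / (2 * (Real.pi : ℂ))‖ *
      ∑' k : ℤ, |autocov P Z k i j|) (fun j _ => h0 i j) (Finset.mem_univ j)).trans
    (Finset.single_le_sum (f := fun i => ∑ j, ‖1 / (2 * (Real.pi : ℂ))‖ *
      ∑' k : ℤ, |autocov P Z k i j|) (fun i _ => Finset.sum_nonneg fun j _ => h0 i j)
      (Finset.mem_univ i))

/-- The spectral extremes are genuine essential bounds: stability makes the spectral density
bounded. -/
lemma ae_specLower_le_and_le_specUpper (h : IsStableGaussianVAR P Z W A Sw) :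
    ∀ᵐ θ ∂(volume.restrict (Set.Icc (-Real.pi) Real.pi)),
      specLower P Z ≤ lambdaMin (spectralDensity P Z θ) ∧
        lambdaMax (spectralDensity P Z θ) ≤ specUpper P Z := by
  obtain ⟨c, hc⟩ := h.exists_norm_spectralDensity_le
  obtain ⟨K, hK0, hK⟩ := exists_abs_le_of_mem_spectrum (𝕜 := ℂ) (ι := ι) c
  have h1 := ae_essInf_le (μ := volume.restrict (Set.Icc (-Real.pi) Real.pi))
    (f := fun θ => lambdaMin (spectralDensity P Z θ))
    (Filter.isBoundedUnder_of ⟨-K, fun θ =>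
      (abs_le.1 (abs_lambdaMin_le hK0 (hK _ (hc θ)))).1⟩)
  have h2 := ae_le_essSup (μ := volume.restrict (Set.Icc (-Real.pi) Real.pi))
    (f := fun θ => lambdaMax (spectralDensity P Z θ))
    (Filter.isBoundedUnder_of ⟨K, fun θ =>
      (abs_le.1 (abs_lambdaMax_le hK0 (hK _ (hc θ)))).2⟩)
  filter_upwards [h1, h2] with θ h3 h4 using ⟨h3, h4⟩

/-- Autocovariances of the projected process `u · Z_t`. -/
noncomputable def projAutocov (P : Measure Ω) (Z : ℤ → Ω → ι → ℝ) (u : ι → ℝ) (k : ℤ) : ℝ :=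
  ∑ i, ∑ j, u i * u j * autocov P Z k i j

lemma summable_projAutocov (h : IsStableGaussianVAR P Z W A Sw) (u : ι → ℝ) :
    Summable fun k => |projAutocov P Z u k| := by
  refine Summable.abs (summable_sum fun i _ => summable_sum fun j _ => ?_)
  exact (summable_abs_iff.1 (h.summable_autocov i j)).mul_left _

lemma scalarSpectralDensity_projAutocov (h : IsStableGaussianVAR P Z W A Sw) (u : ι → ℝ) (θ : ℝ) :
    scalarSpectralDensity (projAutocov P Z u) θ
      = star (fun i => (u i : ℂ)) ⬝ᵥ (spectralDensity P Z θ *ᵥ fun i => (u i : ℂ)) := by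
  have hs : ∀ i j, Summable fun k : ℤ => ((u i * u j : ℝ) : ℂ) *
      ((autocov P Z k i j : ℂ) * Complex.exp (Complex.I * (θ : ℂ) * (k : ℂ))) := by
    intro i j
    refine Summable.mul_left _ (Summable.of_norm ?_)
    simp_rw [norm_mul, norm_cexp_I_mul_int, mul_one, Complex.norm_real, Real.norm_eq_abs]
    exact h.summable_autocov i j
  have h1 : ∀ k : ℤ, (projAutocov P Z u k : ℂ) * Complex.exp (Complex.I * (θ : ℂ) * (k : ℂ))
      = ∑ i, ∑ j, ((u i * u j : ℝ) : ℂ) *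
        ((autocov P Z k i j : ℂ) * Complex.exp (Complex.I * (θ : ℂ) * (k : ℂ))) := by
    intro k
    simp only [projAutocov, Complex.ofReal_sum, Finset.sum_mul, Complex.ofReal_mul]
    exact Finset.sum_congr rfl fun i _ => Finset.sum_congr rfl fun j _ => by ring
  rw [scalarSpectralDensity]
  simp_rw [h1]
  rw [Summable.tsum_finsetSum fun i _ => summable_sum fun j _ => hs i j, Finset.mul_sum,
    dotProduct]
  refine Finset.sum_congr rfl fun i _ => ?_
  rw [Summable.tsum_finsetSum fun j _ => hs i j, Finset.mul_sum, Matrix.mulVec, dotProduct,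
    Finset.mul_sum]
  refine Finset.sum_congr rfl fun j _ => ?_
  rw [tsum_mul_left, spectralDensity_apply, scalarSpectralDensity, Pi.star_apply,
    Complex.star_def, Complex.conj_ofReal]
  push_cast
  ring

lemma ae_scalarSpectralDensity_bounds (h : IsStableGaussianVAR P Z W A Sw) (u : ι → ℝ) :
    ∀ᵐ θ ∂(volume.restrict (Set.Icc (-Real.pi) Real.pi)),
      specLower P Z * ∑ i, u i ^ 2 ≤ (scalarSpectralDensity (projAutocov P Z u) θ).re ∧
        (scalarSpectralDensity (projAutocov P Z u) θ).re ≤ specUpper P Z * ∑ i, u i ^ 2 := by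
  filter_upwards [h.ae_specLower_le_and_le_specUpper] with θ hθ
  have hu : ∑ i, ‖(u i : ℂ)‖ ^ 2 = ∑ i, u i ^ 2 := by
    simp_rw [Complex.norm_real, Real.norm_eq_abs, sq_abs]
  have hu0 : 0 ≤ ∑ i, u i ^ 2 := Finset.sum_nonneg fun i _ => sq_nonneg _
  have h1 := lambdaMin_mul_le (h.isHermitian_spectralDensity θ) fun i => (u i : ℂ)
  have h2 := le_lambdaMax_mul (h.isHermitian_spectralDensity θ) fun i => (u i : ℂ)
  rw [← h.scalarSpectralDensity_projAutocov, hu] at h1 h2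
  exact ⟨(mul_le_mul_of_nonneg_right hθ.1 hu0).trans h1,
    le_trans h2 (mul_le_mul_of_nonneg_right hθ.2 hu0)⟩

lemma specLower_le_specUpper [Nonempty ι] (h : IsStableGaussianVAR P Z W A Sw) :
    specLower P Z ≤ specUpper P Z := by
  have hne : (ae (volume.restrict (Set.Icc (-Real.pi) Real.pi))).NeBot := by
    rw [ae_neBot, Ne, Measure.restrict_eq_zero, Real.volume_Icc]
    simp [Real.pi_pos]
  obtain ⟨θ, h1, h2⟩ := (h.ae_scalarSpectralDensity_bounds fun _ => 1).exists
  have h3 := h1.trans h2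
  have h4 : (0 : ℝ) < ∑ _i : ι, (1 : ℝ) ^ 2 := by simp [Fintype.card_pos]
  exact le_of_mul_le_mul_right h3 h4

/-- The coordinates of `(u · Z_1, …, u · Z_N)`. -/
noncomputable def projSample (Z : ℤ → Ω → ι → ℝ) (N : ℕ) (u : ι → ℝ) (r : Fin N) (x : Ω) : ℝ :=
  ∑ i, u i * Z ((r : ℕ) + 1 : ℤ) x i

lemma integral_projSample_sq (h : IsStableGaussianVAR P Z W A Sw) {N : ℕ} (u : ι → ℝ)
    (w : Fin N → ℝ) :
    ∫ x, (∑ r, w r * projSample Z N u r x) ^ 2 ∂P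
      = ∑ r, ∑ t, w r * w t * projAutocov P Z u ((t : ℤ) - (r : ℤ)) := by
  have h1 : ∀ x, (∑ r, w r * projSample Z N u r x) ^ 2 = ∑ r, ∑ t, ∑ i, ∑ j,
      (w r * w t * (u i * u j)) *
        (Z ((r : ℕ) + 1 : ℤ) x i * Z ((t : ℕ) + 1 : ℤ) x j) := by
    intro x
    rw [sq, Finset.sum_mul_sum]
    refine Finset.sum_congr rfl fun r _ => Finset.sum_congr rfl fun t _ => ?_
    rw [projSample, projSample, mul_mul_mul_comm, Finset.sum_mul_sum, Finset.mul_sum]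
    refine Finset.sum_congr rfl fun i _ => ?_
    rw [Finset.mul_sum]
    exact Finset.sum_congr rfl fun j _ => by ring
  have hi : ∀ r t : Fin N, ∀ i j, Integrable (fun x => (w r * w t * (u i * u j)) *
      (Z ((r : ℕ) + 1 : ℤ) x i * Z ((t : ℕ) + 1 : ℤ) x j)) P := fun r t i j =>
    (h.integrable_mul _ _ i j).const_mul _
  simp_rw [h1]
  rw [integral_finsetSum _ fun r _ => integrable_finsetSum _ fun t _ =>
    integrable_finsetSum _ fun i _ => integrable_finsetSum _ fun j _ => hi r t i j]
  refine Finset.sum_congr rfl fun r _ => ?_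
  rw [integral_finsetSum _ fun t _ =>
    integrable_finsetSum _ fun i _ => integrable_finsetSum _ fun j _ => hi r t i j]
  refine Finset.sum_congr rfl fun t _ => ?_
  rw [integral_finsetSum _ fun i _ => integrable_finsetSum _ fun j _ => hi r t i j,
    projAutocov, Finset.mul_sum]
  refine Finset.sum_congr rfl fun i _ => ?_
  rw [integral_finsetSum _ fun j _ => hi r t i j, Finset.mul_sum]
  refine Finset.sum_congr rfl fun j _ => ?_
  rw [integral_const_mul, h.integral_mul,
    show ((t : ℕ) : ℤ) + 1 - (((r : ℕ) : ℤ) + 1) = (t : ℤ) - (r : ℤ) by ring]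
  ring

lemma hasGaussianLaw_sum_projSample (h : IsStableGaussianVAR P Z W A Sw) {N : ℕ} (u : ι → ℝ)
    (w : Fin N → ℝ) : HasGaussianLaw (fun x => ∑ r, w r * projSample Z N u r x) P := by
  have h1 : IsGaussianProcess (fun (r : Fin N) x => Z ((r : ℕ) + 1 : ℤ) x) P :=
    h.gaussian.comp_right fun r : Fin N => ((r : ℕ) + 1 : ℤ)
  have h2 := (h1.comp_left fun r => w r • ∑ i, u i • ContinuousLinearMap.proj (R := ℝ)
    (φ := fun _ : ι => ℝ) i).hasGaussianLaw_fun_sum (I := Finset.univ)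
  refine h2.congr (Filter.Eventually.of_forall fun x => ?_)
  simp [projSample]

/-- Every projected sample is a centred Gaussian vector whose covariance lies between
`2π 𝔪 ‖u‖²` and `2π 𝓜 ‖u‖²` times the identity. -/
lemma isCentredGaussian_projSample (h : IsStableGaussianVAR P Z W A Sw) (N : ℕ) (u : ι → ℝ) :
    IsCentredGaussian P (projSample Z N u)
      (fun w => ∑ r, ∑ t, w r * w t * projAutocov P Z u ((t : ℤ) - (r : ℤ))) := by
  have hint : ∀ t i, Integrable (fun x => u i * Z t x i) P := fun t i =>
    (h.hasGaussianLaw_coord t i).integrable.const_mul _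
  have hpint : ∀ r, Integrable (projSample Z N u r) P := fun r =>
    integrable_finsetSum _ fun i _ => hint _ i
  refine ⟨fun r => (hpint r).aemeasurable, fun w => ?_, fun w => ?_⟩
  · have hg := h.hasGaussianLaw_sum_projSample u w
    have hmean : ∫ x, ∑ r, w r * projSample Z N u r x ∂P = 0 := by
      rw [integral_finsetSum _ fun r _ => (hpint r).const_mul _]
      refine Finset.sum_eq_zero fun r _ => ?_
      rw [integral_const_mul]
      have : ∫ x, projSample Z N u r x ∂P = 0 := by
        unfold projSample
        rw [integral_finsetSum _ fun i _ => hint _ i]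
        exact Finset.sum_eq_zero fun i _ => by rw [integral_const_mul, h.mean_zero, mul_zero]
      rw [this, mul_zero]
    rw [hg.map_eq_gaussianReal, hmean, ← h.integral_projSample_sq,
      variance_of_integral_eq_zero hg.aemeasurable hmean]
  · rw [← h.integral_projSample_sq]
    exact integral_nonneg fun x => sq_nonneg _

lemma projSample_cov_bounds (h : IsStableGaussianVAR P Z W A Sw) (N : ℕ) (u : ι → ℝ)
    (w : Fin N → ℝ) :
    2 * Real.pi * (specLower P Z * ∑ i, u i ^ 2) * ∑ t, w t ^ 2
        ≤ ∑ r, ∑ t, w r * w t * projAutocov P Z u ((t : ℤ) - (r : ℤ)) ∧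
      ∑ r, ∑ t, w r * w t * projAutocov P Z u ((t : ℤ) - (r : ℤ))
        ≤ 2 * Real.pi * (specUpper P Z * ∑ i, u i ^ 2) * ∑ t, w t ^ 2 :=
  sum_toeplitz_bounds (h.summable_projAutocov u) (h.ae_scalarSpectralDensity_bounds u) w

end IsStableGaussianVAR

/-! ### Contaminated designs -/

section Design

variable {Ω ι : Type*} [Fintype ι]

lemma dataMatrix_add_mulVec (Z : ℤ → Ω → ι → ℝ) (N : ℕ) (E : Matrix (Fin N) ι ℝ) (x : Ω)
    (u : ι → ℝ) (r : Fin N) :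
    ((dataMatrix Z N x + E) *ᵥ u) r
      = IsStableGaussianVAR.projSample Z N u r x + (E *ᵥ u) r := by
  rw [Matrix.add_mulVec, Pi.add_apply]
  congr 1
  exact Finset.sum_congr rfl fun i _ => mul_comm _ _

lemma contaminatedDesign_eq [MeasurableSpace Ω] {ι₁ ι₂ : Type*} (F : ℤ → Ω → ι₁ → ℝ) (X : ℤ → Ω → ι₂ → ℝ) (n : ℕ)
    (DF : Matrix (Fin (n - 1)) ι₁ ℝ) (x : Ω) :
    contaminatedDesign F X n DF x
      = dataMatrix (jointProcess F X) (n - 1) x + Matrix.fromCols DF 0 := by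
  rw [contaminatedDesign]
  congr 1

/-- The column norms of an error matrix are controlled by its largest singular value. -/
lemma sum_sq_col_le_lambdaMax {κ : Type*} [Fintype κ] [DecidableEq ι] {n : ℕ} (hn : 0 < n)
    (E : Matrix κ ι ℝ) (j : ι) : ∑ r, E r j ^ 2 ≤ n * lambdaMax (sampleCov n E) := by
  have hn' : (0 : ℝ) < n := by exact_mod_cast hn
  have hH : (sampleCov n E).IsHermitian := by
    rw [Matrix.IsHermitian, Matrix.conjTranspose_eq_transpose_of_trivial, sampleCov,
      Matrix.transpose_smul, Matrix.transpose_mul, Matrix.transpose_transpose]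
  have h1 := le_lambdaMax_mul hH (Pi.single j (1 : ℝ))
  have h2 : ∑ i, ‖(Pi.single j (1 : ℝ) : ι → ℝ) i‖ ^ 2 = 1 := by
    simp [Pi.single_apply]
  have h3 : RCLike.re (star (Pi.single j (1 : ℝ)) ⬝ᵥ (sampleCov n E *ᵥ Pi.single j (1 : ℝ)))
      = 1 / (n : ℝ) * ∑ r, E r j ^ 2 := by
    simp [sampleCov, Matrix.mul_apply, sq]
  rw [h2, h3, mul_one] at h1
  calc ∑ r, E r j ^ 2 = n * (1 / (n : ℝ) * ∑ r, E r j ^ 2) := by field_simp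
    _ ≤ _ := mul_le_mul_of_nonneg_left h1 hn'.le

end Design

/-- Restricted eigenvalue bound for a deterministically perturbed VAR sample: apart from the two
tail events controlled by the union bound, `‖(𝐙 + E) v‖²` is at least `π 𝔪 n ‖v‖²` up to an `ℓ₁`
term. -/
theorem IsStableGaussianVAR.le_measureReal_restricted_eigenvalue {Ω ι : Type*} [MeasurableSpace Ω]
    [Fintype ι] [DecidableEq ι] {P : Measure Ω} [IsProbabilityMeasure P]
    {Z W : ℤ → Ω → ι → ℝ} {A Sw : Matrix ι ι ℝ} (h : IsStableGaussianVAR P Z W A Sw)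
    (hm : 0 < specLower P Z) (hM : 0 < specUpper P Z) {n s : ℕ} (hs : 1 ≤ s)
    (E : Matrix (Fin (n - 1)) ι ℝ) {e : ℝ} (hE : ∀ j, ∑ r, E r j ^ 2 ≤ n * e) :
    1 - (Fintype.card ι * 2 : ℝ) ^ s * (Real.exp (n / 4) * (√2)⁻¹ ^ (n - 1))
        - Fintype.card ι * (Real.exp (-(3 * n / 4)) * √2 ^ (n - 1)) ≤
      P.real {x | ∀ v : ι → ℝ, Real.pi * specLower P Z * n * ∑ j, v j ^ 2
        - (12 * Real.pi * specUpper P Z + 2 * e) * n / s * (∑ j, |v j|) ^ 2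
          ≤ ∑ r, ((dataMatrix Z (n - 1) x + E) *ᵥ v) r ^ 2} := by
  have hpi := Real.pi_pos
  set m := specLower P Z with hmdef
  set M := specUpper P Z with hMdef
  set G := {x | ∀ v : ι → ℝ, Real.pi * m * n * ∑ j, v j ^ 2
        - (12 * Real.pi * M + 2 * e) * n / s * (∑ j, |v j|) ^ 2
          ≤ ∑ r, ((dataMatrix Z (n - 1) x + E) *ᵥ v) r ^ 2} with hG
  let S₁ : (Fin s → ι × Bool) → Set Ω := fun J =>
    {x | ∑ r, (projSample Z (n - 1) (signedSum J) r x + (E *ᵥ signedSum J) r) ^ 2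
      < (n / 2) * (2 * Real.pi * (m * ∑ j, signedSum J j ^ 2))}
  let S₂ : ι → Set Ω := fun j =>
    {x | (3 * n) * (2 * Real.pi * (M * ∑ i, (Pi.single j (1 : ℝ) : ι → ℝ) i ^ 2))
      ≤ ∑ r, projSample Z (n - 1) (Pi.single j 1) r x ^ 2}
  have hS₁ : ∀ J, P.real (S₁ J) ≤ Real.exp (n / 4) * (√2)⁻¹ ^ (n - 1) := by
    intro J
    have hu0 : 0 ≤ ∑ j, signedSum J j ^ 2 := Finset.sum_nonneg fun j _ => sq_nonneg _
    rcases hu0.eq_or_lt with hu | hu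
    · -- Atoms may cancel; the event is then void.
      have : S₁ J = ∅ := by
        ext x
        simp only [S₁, ← hu, mul_zero, Set.mem_ofPred_eq, Set.mem_empty_iff_false, iff_false,
          not_lt]
        exact Finset.sum_nonneg fun r _ => sq_nonneg _
      rw [this, measureReal_empty]
      positivity
    · have h1 := (h.isCentredGaussian_projSample (n - 1) (signedSum J)).measureReal_sum_sq_lt
        (E *ᵥ signedSum J) (a := 2 * Real.pi * (m * ∑ j, signedSum J j ^ 2)) (by positivity)
        (fun w => (h.projSample_cov_bounds (n - 1) _ w).1) (n / 2)
      rw [Fintype.card_fin, show (n : ℝ) / 2 / 2 = n / 4 by ring] at h1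
      exact h1
  have hS₂ : ∀ j, P.real (S₂ j) ≤ Real.exp (-(3 * n / 4)) * √2 ^ (n - 1) := by
    intro j
    have hu : ∑ i, (Pi.single j (1 : ℝ) : ι → ℝ) i ^ 2 = 1 := by simp [Pi.single_apply]
    have h1 := (h.isCentredGaussian_projSample (n - 1) (Pi.single j 1)).measureReal_le_sum_sq
        (b := 2 * Real.pi * (M * ∑ i, (Pi.single j (1 : ℝ) : ι → ℝ) i ^ 2))
        (by rw [hu]; positivity)
        (fun w => (h.projSample_cov_bounds (n - 1) _ w).2) (3 * n)
    rw [Fintype.card_fin] at h1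
    exact h1
  have hcover : Set.univ ⊆ G ∪ ((⋃ J, S₁ J) ∪ ⋃ j, S₂ j) := by
    intro x _
    by_contra hx
    simp only [Set.mem_union, Set.mem_iUnion, not_or, not_exists] at hx
    obtain ⟨hxG, hx1, hx2⟩ := hx
    apply hxG
    intro v
    refine sum_mulVec_sq_ge_of_signedSum _ (by positivity) hs (fun J => ?_) (fun j => ?_) v
    · have := hx1 J
      simp only [S₁, Set.mem_ofPred_eq, not_lt] at this
      simp_rw [dataMatrix_add_mulVec]
      refine le_trans (le_of_eq ?_) this
      ring
    · have h1 := hx2 j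
      simp only [S₂, Set.mem_ofPred_eq, not_le] at h1
      have hu : ∑ i, (Pi.single j (1 : ℝ) : ι → ℝ) i ^ 2 = 1 := by simp [Pi.single_apply]
      rw [hu] at h1
      have h2 : ∀ r, (dataMatrix Z (n - 1) x + E) r j ^ 2
          ≤ 2 * projSample Z (n - 1) (Pi.single j 1) r x ^ 2 + 2 * E r j ^ 2 := by
        intro r
        have h3 := dataMatrix_add_mulVec Z (n - 1) E x (Pi.single j 1) r
        rw [Matrix.mulVec_single_one, Matrix.mulVec_single_one] at h3
        simp only [Matrix.col_apply] at h3
        rw [h3]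
        nlinarith [sq_nonneg (projSample Z (n - 1) (Pi.single j 1) r x - E r j)]
      calc ∑ r, (dataMatrix Z (n - 1) x + E) r j ^ 2
          ≤ ∑ r, (2 * projSample Z (n - 1) (Pi.single j 1) r x ^ 2 + 2 * E r j ^ 2) :=
            Finset.sum_le_sum fun r _ => h2 r
        _ = 2 * ∑ r, projSample Z (n - 1) (Pi.single j 1) r x ^ 2 + 2 * ∑ r, E r j ^ 2 := by
            rw [Finset.sum_add_distrib, Finset.mul_sum, Finset.mul_sum]
        _ ≤ (12 * Real.pi * M + 2 * e) * n := by linarith [hE j]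
  have h1 : (1 : ℝ) ≤ P.real G + (P.real (⋃ J, S₁ J) + P.real (⋃ j, S₂ j)) := by
    calc (1 : ℝ) = P.real Set.univ := by simp
      _ ≤ P.real (G ∪ ((⋃ J, S₁ J) ∪ ⋃ j, S₂ j)) := measureReal_mono hcover
      _ ≤ _ := (measureReal_union_le _ _).trans (by gcongr; exact measureReal_union_le _ _)
  have h2 : P.real (⋃ J, S₁ J)
      ≤ (Fintype.card ι * 2 : ℝ) ^ s * (Real.exp (n / 4) * (√2)⁻¹ ^ (n - 1)) := by
    refine (measureReal_iUnion_fintype_le _).trans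
      ((Finset.sum_le_sum fun J _ => hS₁ J).trans_eq ?_)
    simp
  have h3 : P.real (⋃ j, S₂ j)
      ≤ Fintype.card ι * (Real.exp (-(3 * n / 4)) * √2 ^ (n - 1)) := by
    refine (measureReal_iUnion_fintype_le _).trans
      ((Finset.sum_le_sum fun j _ => hS₂ j).trans_eq ?_)
    simp
  linarith

/-! ### Constants -/

lemma rscCurvature_pos {m M d c₀ : ℝ} (hm : 0 < m) (hmM : m ≤ M) (hd : 0 ≤ d)
    (hc₀ : 6 * √(165 * Real.pi) ≤ c₀) (hdm : c₀ * d < m / √M) : 0 < rscCurvature m M d := by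
  have hpi := Real.pi_pos
  have hpi1 : 1 < Real.pi := by linarith [Real.pi_gt_three]
  have hM : 0 < M := hm.trans_le hmM
  have hsM : 0 < √M := Real.sqrt_pos.2 hM
  have h1 : 54 * √(2 * Real.pi * M + Real.pi * m / 27) ≤ 6 * √(165 * Real.pi) * √M := by
    have h2 : √(2 * Real.pi * M + Real.pi * m / 27) ≤ √(55 / 27 * Real.pi * M) := by
      apply Real.sqrt_le_sqrt
      have := mul_le_mul_of_nonneg_left hmM hpi.le
      linarith
    have h3 : 54 * √(55 / 27 * Real.pi * M) = 6 * √(165 * Real.pi) * √M := by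
      rw [mul_assoc 6, ← Real.sqrt_mul (by positivity), show (54 : ℝ) = 6 * 9 by norm_num,
        mul_assoc 6]
      congr 1
      rw [show (9 : ℝ) = √81 by rw [show (81 : ℝ) = 9 ^ 2 by norm_num]; simp,
        ← Real.sqrt_mul (by norm_num)]
      congr 1
      ring
    linarith
  have h4 : c₀ * d * √M < m := (lt_div_iff₀ hsM).1 hdm
  have h5 : 54 * d * √(2 * Real.pi * M + Real.pi * m / 27) < m := by
    calc 54 * d * √(2 * Real.pi * M + Real.pi * m / 27)
        = d * (54 * √(2 * Real.pi * M + Real.pi * m / 27)) := by ring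
      _ ≤ d * (6 * √(165 * Real.pi) * √M) := mul_le_mul_of_nonneg_left h1 hd
      _ = 6 * √(165 * Real.pi) * (d * √M) := by ring
      _ ≤ c₀ * (d * √M) := mul_le_mul_of_nonneg_right hc₀ (by positivity)
      _ < m := by linarith
  have h6 : m < Real.pi * m := by nlinarith
  rw [rscCurvature]
  linarith

lemma tolerance_le_rscTolerance {m M d : ℝ} (hm : 0 < m) (hmM : m ≤ M) (hd : 0 ≤ d) {p n : ℕ}
    (hp : 1 ≤ p) (hn : 0 < n) (hlog : 100 * Real.log p ≤ n) :
    650 * Real.pi * M * (Real.log p / n) ≤ rscTolerance m M d p n := by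
  have hpi := Real.pi_pos
  have hn' : (0 : ℝ) < n := by exact_mod_cast hn
  have hM : 0 < M := hm.trans_le hmM
  have hL : 0 ≤ Real.log p := Real.log_nonneg (by exact_mod_cast hp)
  set q := √(Real.log p / n) with hq
  have hq0 : 0 ≤ q := Real.sqrt_nonneg _
  have hq2 : Real.log p / n = q ^ 2 := (Real.sq_sqrt (by positivity)).symm
  have hq1 : q ≤ 1 := by
    rw [hq, Real.sqrt_le_iff, one_pow, div_le_one hn']
    exact ⟨zero_le_one, by linarith⟩
  have h1 : 650 * Real.pi * M * (Real.log p / n) ≤ 1458 * Real.pi * M * q := by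
    rw [hq2]
    have : q ^ 2 ≤ q := by nlinarith
    have h2 : 650 * Real.pi * M * q ^ 2 ≤ 650 * Real.pi * M * q :=
      mul_le_mul_of_nonneg_left this (by positivity)
    have h3 : 0 ≤ Real.pi * M * q := by positivity
    linarith
  have h4 : 1458 * Real.pi * M ≤ Real.pi / 2 * m * (54 * (M / m)) ^ 2 := by
    have h5 : Real.pi / 2 * m * (54 * (M / m)) ^ 2 = 1458 * Real.pi * M * (M / m) := by
      field_simp
      ring
    rw [h5]
    exact le_mul_of_one_le_right (by positivity) ((one_le_div hm).2 hmM)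
  rw [rscTolerance, ← hq]
  refine h1.trans (mul_le_mul_of_nonneg_right (h4.trans ?_) hq0)
  refine mul_le_mul_of_nonneg_right ?_ (sq_nonneg _)
  have : 0 ≤ 27 * d * √(2 * Real.pi * M + Real.pi * m / 27) := by positivity
  linarith

/-- With `s ≈ n / (50 log p)` atoms the union bound loses only a fraction of the exponent. -/
lemma union_bound_le {p n s : ℕ} (hp : 2 ≤ p) (hn : 0 < n) (hlog : 100 * Real.log p ≤ n)
    (hs : s * Real.log p ≤ n / 50) :
    (p * 2 : ℝ) ^ s * (Real.exp (n / 4) * (√2)⁻¹ ^ (n - 1))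
      + p * (Real.exp (-(3 * n / 4)) * √2 ^ (n - 1)) ≤ 3 * Real.exp (-(1 / 20 * n)) := by
  have hn' : (0 : ℝ) < n := by exact_mod_cast hn
  have hp' : (2 : ℝ) ≤ p := by exact_mod_cast hp
  have hp0 : (0 : ℝ) < p := by linarith
  have hcast : ((n - 1 : ℕ) : ℝ) = n - 1 := by
    rw [Nat.cast_sub hn]; simp
  have h2 : √2 = Real.exp (Real.log 2 / 2) := by
    rw [← Real.log_sqrt (by norm_num), Real.exp_log (by positivity)]
  have hl1 := mul_le_mul_of_nonneg_left Real.log_two_gt_d9.le hn'.le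
  have hl2 := mul_le_mul_of_nonneg_left Real.log_two_lt_d9.le hn'.le
  have hl3 : 0 < Real.log 2 := Real.log_pos (by norm_num)
  have e1 : √2 ^ (n - 1) = Real.exp ((n - 1) * (Real.log 2 / 2)) := by
    rw [h2, ← Real.exp_nat_mul, hcast]
  have e2 : (√2)⁻¹ ^ (n - 1) = Real.exp (-((n - 1) * (Real.log 2 / 2))) := by
    rw [inv_pow, e1, ← Real.exp_neg]
  have e3 : (p * 2 : ℝ) ^ s ≤ Real.exp (n / 25) := by
    calc (p * 2 : ℝ) ^ s ≤ ((p : ℝ) * p) ^ s := by gcongr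
      _ = Real.exp (s * (2 * Real.log p)) := by
        rw [Real.exp_nat_mul, two_mul, Real.exp_add, Real.exp_log hp0]
      _ ≤ _ := Real.exp_le_exp.2 (by linarith)
  have e4 : (p : ℝ) ≤ Real.exp (n / 100) := by
    rw [← Real.log_le_iff_le_exp hp0]
    linarith
  have t1 : (p * 2 : ℝ) ^ s * (Real.exp (n / 4) * (√2)⁻¹ ^ (n - 1))
      ≤ 2 * Real.exp (-(1 / 20 * n)) := by
    calc (p * 2 : ℝ) ^ s * (Real.exp (n / 4) * (√2)⁻¹ ^ (n - 1))
        ≤ Real.exp (n / 25) * (Real.exp (n / 4) * (√2)⁻¹ ^ (n - 1)) :=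
          mul_le_mul_of_nonneg_right e3 (by positivity)
      _ = Real.exp (n / 25 + (n / 4 + -((n - 1) * (Real.log 2 / 2)))) := by
          rw [e2, ← Real.exp_add, ← Real.exp_add]
      _ ≤ Real.exp (Real.log 2 + -(1 / 20 * n)) := Real.exp_le_exp.2 (by linarith)
      _ = _ := by rw [Real.exp_add, Real.exp_log (by norm_num)]
  have t2 : p * (Real.exp (-(3 * n / 4)) * √2 ^ (n - 1)) ≤ Real.exp (-(1 / 20 * n)) := by
    calc p * (Real.exp (-(3 * n / 4)) * √2 ^ (n - 1))
        ≤ Real.exp (n / 100) * (Real.exp (-(3 * n / 4)) * √2 ^ (n - 1)) :=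
          mul_le_mul_of_nonneg_right e4 (by positivity)
      _ = Real.exp (n / 100 + (-(3 * n / 4) + (n - 1) * (Real.log 2 / 2))) := by
          rw [e1, ← Real.exp_add, ← Real.exp_add]
      _ ≤ _ := Real.exp_le_exp.2 (by linarith)
  linarith

/-- With `L = log p` and `x = n`, a number `s` of atoms for Maurey's method that is of order `x / L`:
small enough for the union bound and large enough for the `1 / s` term. -/
lemma exists_atom_count {L x : ℝ} (hL : 0 < L) (hx : 100 * L ≤ x) :
    ∃ s : ℕ, 1 ≤ s ∧ s * L ≤ x / 50 ∧ (1 : ℝ) / s ≤ 100 * (L / x) := by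
  have hx0 : 0 < x := by linarith
  have h1 : 2 ≤ x / (50 * L) := by rw [le_div_iff₀ (by positivity)]; linarith
  have h2 := Nat.floor_le (by linarith : 0 ≤ x / (50 * L))
  have h3 := Nat.lt_floor_add_one (x / (50 * L))
  have h5 : x / (50 * L) / 2 ≤ (⌊x / (50 * L)⌋₊ : ℝ) := by linarith
  refine ⟨⌊x / (50 * L)⌋₊, Nat.one_le_floor_iff _ |>.2 (by linarith), ?_, ?_⟩
  · have := mul_le_mul_of_nonneg_right h2 hL.le
    refine this.trans_eq ?_
    field_simp
  · have h6 : 0 < x / (50 * L) / 2 := by linarith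
    refine (one_div_le_one_div_of_le h6 h5).trans_eq ?_
    field_simp
    norm_num

/-! ### Restricted strong convexity -/

theorem lemma6 :
    ∃ C c₁ c₂ : ℝ, 0 < C ∧ 0 < c₁ ∧ 0 < c₂ ∧
      ∀ (c₀ : ℝ) (_ : 6 ≤ c₀) (p₁ p₂ n : ℕ) (_ : 1 ≤ p₁) (_ : 1 ≤ p₂)
        (_ : C * Real.log ((p₁ + p₂ : ℕ) : ℝ) ≤ (n : ℝ))
        {Ω : Type*} [MeasurableSpace Ω] (P : Measure Ω) [IsProbabilityMeasure P]
        (F : ℤ → Ω → Fin p₁ → ℝ) (X : ℤ → Ω → Fin p₂ → ℝ)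
        (W : ℤ → Ω → Fin p₁ ⊕ Fin p₂ → ℝ)
        (A Sw : Matrix (Fin p₁ ⊕ Fin p₂) (Fin p₁ ⊕ Fin p₂) ℝ)
        (_ : IsStableGaussianVAR P (jointProcess F X) W A Sw)
        (DF : Matrix (Fin (n - 1)) (Fin p₁) ℝ)
        (m M d : ℝ)
        (_ : m = specLower P (jointProcess F X))
        (_ : M = specUpper P (jointProcess F X))
        (_ : d = Real.sqrt (lambdaMax (sampleCov n DF)))
        (_ : c₀ * d < m / Real.sqrt M),
        (6 * Real.sqrt (165 * Real.pi) ≤ c₀ → 0 < rscCurvature m M d) ∧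
        (0 < rscCurvature m M d →
          1 - c₁ * Real.exp (-(c₂ * n)) ≤
            P.real {x | SatisfiesRSC n (contaminatedDesign F X n DF x)
              (rscCurvature m M d) (rscTolerance m M d (p₁ + p₂) n)}) := by
  refine ⟨100, 3, 1 / 20, by norm_num, by norm_num, by norm_num, ?_⟩
  intro c₀ hc₀ p₁ p₂ n hp₁ hp₂ hlog Ω _ P _ F X W A Sw h DF m M d hm hM hd hdm
  have hpi := Real.pi_pos
  have hd0 : 0 ≤ d := hd ▸ Real.sqrt_nonneg _
  have hquot : 0 < m / √M := lt_of_le_of_lt (by positivity) hdm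
  -- `√M = 0` would make the quotient vanish, so both extremes are positive.
  have hsM : 0 < √M := by
    refine (Real.sqrt_nonneg M).lt_of_ne' fun h0 => ?_
    rw [h0, div_zero] at hquot
    exact lt_irrefl _ hquot
  have hM0 : 0 < M := Real.sqrt_pos.1 hsM
  have hm0 : 0 < m := by
    have := mul_pos hquot hsM
    rwa [div_mul_cancel₀ _ hsM.ne'] at this
  have : Nonempty (Fin p₁ ⊕ Fin p₂) := ⟨Sum.inl ⟨0, hp₁⟩⟩
  have hmM : m ≤ M := by rw [hm, hM]; exact h.specLower_le_specUpper
  refine ⟨fun h0 => rscCurvature_pos hm0 hmM hd0 h0 hdm, fun hα => ?_⟩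
  have hp : 2 ≤ p₁ + p₂ := by omega
  have hL : 0 < Real.log ((p₁ + p₂ : ℕ) : ℝ) := Real.log_pos (by exact_mod_cast hp)
  have hn' : (0 : ℝ) < n := by linarith
  have hn : 0 < n := by exact_mod_cast hn'
  obtain ⟨s, hs1, hsL, hsinv⟩ := exists_atom_count hL hlog
  have hd2 : d ^ 2 ≤ M / 36 := by
    have h1 : 6 * d * √M ≤ m :=
      ((mul_le_mul_of_nonneg_right (mul_le_mul_of_nonneg_right hc₀ hd0) hsM.le).trans
        ((lt_div_iff₀ hsM).1 hdm).le)
    have h2 : (6 * d * √M) ^ 2 ≤ M ^ 2 := pow_le_pow_left₀ (by positivity) (h1.trans hmM) 2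
    rw [mul_pow, Real.sq_sqrt hM0.le, sq M, mul_pow] at h2
    have h3 := le_of_mul_le_mul_right h2 hM0
    linarith
  have hE : ∀ j, ∑ r, (Matrix.fromCols DF (0 : Matrix (Fin (n - 1)) (Fin p₂) ℝ)) r j ^ 2
      ≤ n * d ^ 2 := by
    rintro (j | j)
    · have h1 := sum_sq_col_le_lambdaMax hn DF j
      have h2 : 0 ≤ lambdaMax (sampleCov n DF) := by
        have h3 : 0 ≤ ∑ r, DF r j ^ 2 := Finset.sum_nonneg fun r _ => sq_nonneg _
        exact nonneg_of_mul_nonneg_right (h3.trans h1) hn'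
      rw [hd, Real.sq_sqrt h2]
      simpa using h1
    · simp only [Matrix.fromCols_apply_inr, Matrix.zero_apply]
      simp
      positivity
  have hmain := h.le_measureReal_restricted_eigenvalue (hm ▸ hm0) (hM ▸ hM0) hs1 _ hE
  rw [← hm, ← hM, Fintype.card_sum, Fintype.card_fin, Fintype.card_fin] at hmain
  have hunion := union_bound_le hp hn hlog hsL
  refine (le_trans ?_ hmain).trans (measureReal_mono fun x hx => ?_)
  · linarith
  have hτ := tolerance_le_rscTolerance hm0 hmM hd0 (p := p₁ + p₂) (by omega) hn hlog
  have hτ0 : 0 ≤ rscTolerance m M d (p₁ + p₂) n := le_trans (by positivity) hτ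
  refine ⟨hα, hτ0, fun D => ?_⟩
  have hK : 0 ≤ (12 * Real.pi * M + 2 * d ^ 2) * n / s := by positivity
  have h1 := frobSq_mul_ge _ hK hx D
  rw [← contaminatedDesign_eq] at h1
  have hF : 0 ≤ frobSq D := Finset.sum_nonneg fun _ _ => Finset.sum_nonneg fun _ _ => sq_nonneg _
  have hαm : rscCurvature m M d ≤ Real.pi * m := by
    have : 0 ≤ 54 * d * √(2 * Real.pi * M + Real.pi * m / 27) := by positivity
    rw [rscCurvature]
    linarith
  have hK' : (12 * Real.pi * M + 2 * d ^ 2) / (2 * s) ≤ rscTolerance m M d (p₁ + p₂) n := by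
    have h2 : 12 * Real.pi * M + 2 * d ^ 2 ≤ 13 * Real.pi * M := by
      have : M ≤ Real.pi * M := by nlinarith [Real.pi_gt_three]
      linarith
    calc (12 * Real.pi * M + 2 * d ^ 2) / (2 * s)
        = (12 * Real.pi * M + 2 * d ^ 2) / 2 * (1 / s) := by field_simp
      _ ≤ 13 * Real.pi * M / 2 * (100 * (Real.log ((p₁ + p₂ : ℕ) : ℝ) / n)) :=
          mul_le_mul (by linarith) hsinv (by positivity) (by positivity)
      _ = 650 * Real.pi * M * (Real.log ((p₁ + p₂ : ℕ) : ℝ) / n) := by ring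
      _ ≤ _ := hτ
  calc rscCurvature m M d / 2 * frobSq D - rscTolerance m M d (p₁ + p₂) n * elemL1 D ^ 2
      ≤ Real.pi * m / 2 * frobSq D
          - (12 * Real.pi * M + 2 * d ^ 2) / (2 * s) * elemL1 D ^ 2 :=
        sub_le_sub (mul_le_mul_of_nonneg_right (by linarith) hF)
          (mul_le_mul_of_nonneg_right hK' (sq_nonneg _))
    _ = 1 / (2 * (n : ℝ)) * (Real.pi * m * n * frobSq D
          - (12 * Real.pi * M + 2 * d ^ 2) * n / s * elemL1 D ^ 2) := by
        have : (s : ℝ) ≠ 0 := by positivity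
        field_simp
    _ ≤ 1 / (2 * (n : ℝ)) * frobSq (contaminatedDesign F X n DF x * D) :=
        mul_le_mul_of_nonneg_left h1 (by positivity)
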